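/- Let $\mathbb K=\mathbb R$ or $\mathbb C$, let $\alpha,\beta,k\in\mathbb K$ be constants with $k\neq 0$ (in the setting of the equianharmonic Lamé equation $\Phi_{\tilde z\tilde z}-20\wp(\tilde z,0,g_3)\Phi=0$ one has $k=2i/g_3^{1/6}$), and fix a square root $\sqrt k\in\mathbb K$; put $\sqrt{2/k}=\sqrt2/\sqrt k$, $\sqrt{2k}=\sqrt2\sqrt k$, $\sqrt{2/k^3}=\sqrt2/(\sqrt k)^3$, $k^{3/2}=(\sqrt k)^3$, $\sqrt{k/2}=\sqrt k/\sqrt 2$. Put $$Y=\alpha(2r^3-1)+\beta r(r^3-2),$$ and let $\Omega$ be a non-empty open subset of $\{(r,y,z,p,q)\in\mathbb K^5: r^3+1\neq0,\ Y(r)\neq 0\}$. Consider on $\Omega$ the distribution $\mathcal D$ spanned by $$X^1=\partial_q,\qquad X^2=\frac{2Y^2}{k(r^3+1)^2}\partial_r+\frac{Y^3}{(r^3+1)^4}p\,\partial_y+\frac{Y^3}{(r^3+1)^4}q\,\partial_p+\frac{Y^6}{(r^3+1)^8}q^2\,\partial_z .$$ Then $\mathcal D$ is a $(2,3,5)$-distribution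 (rank $2$, with first and second derived distributions of rank $3$ and $5$). It is maximally symmetric, i.e. locally diffeomorphic (biholomorphic if $\mathbb K=\mathbb C$) to the flat Cartan distribution, the common kernel of $da_1+(a_3+\frac12a_4a_5)da_4$, $da_2+(a_3-\frac12a_4a_5)da_5$, $da_3+\frac12a_4da_5-\frac12a_5da_4$. It is the common kernel of $$\omega_1=dy-\frac p2\frac{k\Phi}{(1+r^3)^{2/3}}dr,\quad \omega_2=dp-\frac q2\frac{k\Phi}{(1+r^3)^{2/3}}dr,\quad \omega_3=dz-\frac{q^2}2\frac{k\Phi^4}{(1+r^3)^{2/3}}dr,$$ where $\Phi=\alpha\frac{2r^3-1}{(r^3+1)^{4/3}}+\beta\frac{r(r^3-2)}{(r^3+1)^{4/3}}$ (for any choice of the cube root of $r^3+1$, the same one throughout). Let $$c_1=-\tfrac34\sqrt{\tfrac2{k^3}}\,y+\frac{\sqrt2}{8\sqrt k}\frac{r(3\beta r^4+\alpha(4r^3+1))}{r^3+1}p+\frac{\sqrt{2k}}{16}\frac{r^2Y^2}{(r^3+1)^3}q,$$ $$\begin{aligned}c_2={}&6z-\frac{288}{k^3}y^2+\frac8k\frac{(\beta(7r^4+4r)+\alpha(8r^3+5))(\beta(2r^3-1)+3\alpha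 r^2)}{(r^3+1)^2}p^2+3k\frac{rY^4}{(r^3+1)^6}q^2\\&+\frac{96}{k^2}\frac{(3\beta r^4+\alpha(4r^3+1))r}{r^3+1}yp+\frac{48}k\frac{r^2Y^2}{(r^3+1)^3}yq+8\frac{(\alpha(5r^3+2)+\beta(4r^4+r))Y^2}{(r^3+1)^4}pq,\end{aligned}$$ $$c_3=-\sqrt{\tfrac2k}(\beta r+\alpha)p-\frac{\sqrt{2k}}4\frac{rY^2}{(r^3+1)^3}q,$$ $$\begin{aligned}Z^1={}&-\frac{\sqrt2\,k^{3/2}r}{4(r^3+1)}\partial_y+\frac{2\sqrt{2k}}{(r^3+1)^3}\Big(-\frac{2\beta}k(r^3+1)^3p+Y^2q\Big)\partial_z+\sqrt{\tfrac k2}\,\frac{4r^3+1}Y\partial_p\\&-2\sqrt{\tfrac2k}\,\frac{(r^3+1)^3(6\alpha r^2+\beta(5r^3-1))}{Y^3}\partial_q .\end{aligned}$$ Then the vector fields on $\Omega$ $$\begin{aligned}S^1={}&24\Big(\frac{8(r^3+1)^3}{k^2Y^2}y+\frac{4(r^3+1)^2r(\alpha+\beta r)}{kY^2}p+\frac{9\alpha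 r^2+\beta(r^6+8r^3-2)}{(r^3+1)Y}q\Big)X^1-\frac{4k(r^3+1)^2}{Y^2}X^2,\\ S^2={}&\frac{\sqrt2(r^3+1)^3}{4\sqrt k\,Y^2}X^1,\qquad S^3=-c_1S^1+c_2S^2-c_3^2Z^1\end{aligned}$$ are smooth (holomorphic if $\mathbb K=\mathbb C$) and pairwise bracket-generate the Lie algebra of split $\mathfrak g_2$. This means the following. Put $S^4=[S^1,S^2]$, $S^5=[S^2,S^3]$, $S^6=[S^3,S^1]$, $L^1=[S^1,S^4]$, $L^2=[S^2,S^4]$, $L^3=[S^2,S^5]$, $L^4=[S^3,S^5]$, $L^5=[S^3,S^6]$, $L^6=[S^1,S^6]$, $H=[S^2,S^6]$, $h=[S^4,S^3]$, $h^1=\frac14(h-H)$, $h^2=\frac{\sqrt3}{12}(h+H)$. Then the $14$ vector fields $S^1,\dots,S^6,h^1,h^2,L^1,\dots,L^6$ are linearly independent (over $\mathbb K$); their real span is a Lie algebra isomorphic to the split real form of $\mathfrak g_2$; $h^1,h^2$ span a Cartan subalgebra of it; and each of the other twelve fields $V$ is a root vector, $[h^1,V]=aV$, $[h^2,V]=bV$,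 with $(a,b)$ its position in the root diagram: $$S^1:(1,0),\ S^2:(-\tfrac12,\tfrac{\sqrt3}2),\ S^3:(-\tfrac12,-\tfrac{\sqrt3}2),\ S^4:(\tfrac12,\tfrac{\sqrt3}2),\ S^5:(-1,0),\ S^6:(\tfrac12,-\tfrac{\sqrt3}2),$$ $$L^1:(\tfrac32,\tfrac{\sqrt3}2),\ L^2:(0,\sqrt3),\ L^3:(-\tfrac32,\tfrac{\sqrt3}2),\ L^4:(-\tfrac32,-\tfrac{\sqrt3}2),\ L^5:(0,-\sqrt3),\ L^6:(\tfrac32,-\tfrac{\sqrt3}2).$$ -/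

import Mathlib

open scoped ContDiff Topology

noncomputable section

namespace LameG2

/-! ### Vector fields on an open subset of `𝕜⁵`, `𝕜 = ℝ` or `ℂ`

The coordinates are `x 0 = r`, `x 1 = y`, `x 2 = z`, `x 3 = p`, `x 4 = q`. -/

/-- The coordinate space `𝕜⁵`. -/
abbrev Coord (𝕜 : Type*) : Type _ := Fin 5 → 𝕜

/-- The real vector space of smooth (holomorphic if `𝕜 = ℂ`) vector fields on the open set `Ω`.
A vector field on `Ω` is represented by its extension by zero to the whole space, so that two
elements are equal exactly when they agree on `Ω`. -/
def SmoothFields (𝕜 : Type*) [RCLike 𝕜] (Ω : TopologicalSpace.Opens (Coord 𝕜)) :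
    Submodule ℝ (Coord 𝕜 → Coord 𝕜) where
  carrier := {X | ContDiffOn 𝕜 ∞ X Ω ∧ ∀ x ∉ Ω, X x = 0}
  zero_mem' := ⟨contDiffOn_const, fun _ _ => rfl⟩
  add_mem' := fun {X Y} hX hY =>
    ⟨hX.1.add hY.1, fun x hx => by simp [hX.2 x hx, hY.2 x hx]⟩
  smul_mem' := fun t X hX =>
    ⟨by
      have h : t • X = fun x => ((t : ℝ) : 𝕜) • X x := by
        funext x i
        simp [RCLike.real_smul_eq_coe_mul]
      rw [h]
      exact hX.1.const_smul ((t : ℝ) : 𝕜),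
     fun x hx => by simp [hX.2 x hx]⟩

section LieStructure

variable {𝕜 : Type*} [RCLike 𝕜] {Ω : TopologicalSpace.Opens (Coord 𝕜)}

theorem SmoothFields.contDiffAt (X : SmoothFields 𝕜 Ω) {x : Coord 𝕜} (hx : x ∈ Ω) :
    ContDiffAt 𝕜 ∞ X.1 x :=
  X.2.1.contDiffAt (Ω.isOpen.mem_nhds hx)

theorem SmoothFields.differentiableAt (X : SmoothFields 𝕜 Ω) {x : Coord 𝕜} (hx : x ∈ Ω) :
    DifferentiableAt 𝕜 X.1 x :=
  (SmoothFields.contDiffAt X hx).differentiableAt (by simp)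

theorem SmoothFields.ext_on {X Y : SmoothFields 𝕜 Ω} (h : ∀ x ∈ Ω, X.1 x = Y.1 x) : X = Y := by
  apply Subtype.ext
  funext x
  by_cases hx : x ∈ Ω
  · exact h x hx
  · rw [X.2.2 x hx, Y.2.2 x hx]

/-- The vector field on `Ω` given by a function that is smooth on `Ω`. -/
def SmoothFields.mk (X : Coord 𝕜 → Coord 𝕜) (hX : ContDiffOn 𝕜 ∞ X Ω) : SmoothFields 𝕜 Ω :=
  ⟨(Ω : Set (Coord 𝕜)).indicator X,
    hX.congr fun _ hx => Set.indicator_of_mem hx X,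
    fun _ hx => Set.indicator_of_notMem hx X⟩

theorem SmoothFields.mk_apply (X : Coord 𝕜 → Coord 𝕜) (hX : ContDiffOn 𝕜 ∞ X Ω)
    {x : Coord 𝕜} (hx : x ∈ Ω) : (SmoothFields.mk X hX).1 x = X x :=
  Set.indicator_of_mem (s := (Ω : Set (Coord 𝕜))) hx X

/-- The Lie bracket `[X, Y] = DY(X) - DX(Y)` of vector fields on `Ω`. -/
instance : Bracket (SmoothFields 𝕜 Ω) (SmoothFields 𝕜 Ω) where
  bracket X Y := SmoothFields.mk (VectorField.lieBracket 𝕜 X.1 Y.1) fun _ hx =>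
    ((SmoothFields.contDiffAt X hx).lieBracket_vectorField (SmoothFields.contDiffAt Y hx) (by simp)).contDiffWithinAt

theorem SmoothFields.bracket_apply (X Y : SmoothFields 𝕜 Ω) {x : Coord 𝕜} (hx : x ∈ Ω) :
    (⁅X, Y⁆ : SmoothFields 𝕜 Ω).1 x = VectorField.lieBracket 𝕜 X.1 Y.1 x :=
  SmoothFields.mk_apply _ _ hx

theorem SmoothFields.bracket_eventuallyEq (X Y : SmoothFields 𝕜 Ω) {x : Coord 𝕜} (hx : x ∈ Ω) :
    (⁅X, Y⁆ : SmoothFields 𝕜 Ω).1 =ᶠ[𝓝 x] VectorField.lieBracket 𝕜 X.1 Y.1 := by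
  filter_upwards [Ω.isOpen.mem_nhds hx] with u hu
  exact SmoothFields.bracket_apply X Y hu

instance : LieRing (SmoothFields 𝕜 Ω) where
  add_lie X Y Z := SmoothFields.ext_on fun x hx => by
    rw [SmoothFields.bracket_apply _ _ hx]
    change _ = (⁅X, Z⁆ : SmoothFields 𝕜 Ω).1 x + (⁅Y, Z⁆ : SmoothFields 𝕜 Ω).1 x
    rw [SmoothFields.bracket_apply _ _ hx, SmoothFields.bracket_apply _ _ hx]
    exact VectorField.lieBracket_add_left (SmoothFields.differentiableAt X hx) (SmoothFields.differentiableAt Y hx)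
  lie_add X Y Z := SmoothFields.ext_on fun x hx => by
    rw [SmoothFields.bracket_apply _ _ hx]
    change _ = (⁅X, Y⁆ : SmoothFields 𝕜 Ω).1 x + (⁅X, Z⁆ : SmoothFields 𝕜 Ω).1 x
    rw [SmoothFields.bracket_apply _ _ hx, SmoothFields.bracket_apply _ _ hx]
    exact VectorField.lieBracket_add_right (SmoothFields.differentiableAt Y hx) (SmoothFields.differentiableAt Z hx)
  lie_self X := SmoothFields.ext_on fun x hx => by
    rw [SmoothFields.bracket_apply _ _ hx, VectorField.lieBracket_self]
    rfl
  leibniz_lie X Y Z := SmoothFields.ext_on fun x hx => by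
    change _ = (⁅⁅X, Y⁆, Z⁆ : SmoothFields 𝕜 Ω).1 x + (⁅Y, ⁅X, Z⁆⁆ : SmoothFields 𝕜 Ω).1 x
    rw [SmoothFields.bracket_apply _ _ hx, SmoothFields.bracket_apply _ _ hx,
      SmoothFields.bracket_apply _ _ hx,
      Filter.EventuallyEq.lieBracket_vectorField_eq (Filter.EventuallyEq.refl _ _)
        (SmoothFields.bracket_eventuallyEq Y Z hx),
      Filter.EventuallyEq.lieBracket_vectorField_eq (SmoothFields.bracket_eventuallyEq X Y hx)
        (Filter.EventuallyEq.refl _ _),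
      Filter.EventuallyEq.lieBracket_vectorField_eq (Filter.EventuallyEq.refl _ _)
        (SmoothFields.bracket_eventuallyEq X Z hx)]
    exact VectorField.leibniz_identity_lieBracket (n := ∞)
      (by rw [minSmoothness_of_isRCLikeNormedField]; exact WithTop.coe_le_coe.2 le_top)
      (SmoothFields.contDiffAt X hx) (SmoothFields.contDiffAt Y hx) (SmoothFields.contDiffAt Z hx)

instance : LieAlgebra ℝ (SmoothFields 𝕜 Ω) where
  lie_smul t X Y := SmoothFields.ext_on fun x hx => by
    rw [SmoothFields.bracket_apply _ _ hx]
    change _ = t • (⁅X, Y⁆ : SmoothFields 𝕜 Ω).1 x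
    rw [SmoothFields.bracket_apply _ _ hx]
    have h : (t • Y : SmoothFields 𝕜 Ω).1 = ((t : ℝ) : 𝕜) • Y.1 := by
      funext u i
      simp [RCLike.real_smul_eq_coe_mul]
    rw [h, VectorField.lieBracket_const_smul_right (SmoothFields.differentiableAt Y hx)]
    funext i
    simp [RCLike.real_smul_eq_coe_mul]

end LieStructure

/-! ### Pairwise bracket generation of split `𝔤₂` -/

section BracketGeneration

variable {L : Type*} [LieRing L] [LieAlgebra ℝ L]

/-- `h¹ = (h - H) / 4`, where `h = [S⁴, S³]`, `H = [S², S⁶]`, `S⁴ = [S¹, S²]`, `S⁶ = [S³, S¹]`. -/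
def cartanOne (S₁ S₂ S₃ : L) : L :=
  (1 / 4 : ℝ) • (⁅⁅S₁, S₂⁆, S₃⁆ - ⁅S₂, ⁅S₃, S₁⁆⁆)

/-- `h² = √3 (h + H) / 12`. -/
def cartanTwo (S₁ S₂ S₃ : L) : L :=
  (√3 / 12 : ℝ) • (⁅⁅S₁, S₂⁆, S₃⁆ + ⁅S₂, ⁅S₃, S₁⁆⁆)

/-- The fourteen elements `S¹, …, S⁶, h¹, h², L¹, …, L⁶` obtained from `S¹, S², S³`. -/
def bracketFamily (S₁ S₂ S₃ : L) : Fin 14 → L :=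
  let S₄ := ⁅S₁, S₂⁆
  let S₅ := ⁅S₂, S₃⁆
  let S₆ := ⁅S₃, S₁⁆
  ![S₁, S₂, S₃, S₄, S₅, S₆, cartanOne S₁ S₂ S₃, cartanTwo S₁ S₂ S₃,
    ⁅S₁, S₄⁆, ⁅S₂, S₄⁆, ⁅S₂, S₅⁆, ⁅S₃, S₅⁆, ⁅S₃, S₆⁆, ⁅S₁, S₆⁆]

/-- The root diagram of `𝔤₂`: the position of each of the fourteen elements in the plane, in the
same order. -/
def rootDiagram : Fin 14 → ℝ × ℝ :=
  ![(1, 0), (-1 / 2, √3 / 2), (-1 / 2, -√3 / 2), (1 / 2, √3 / 2), (-1, 0), (1 / 2, -√3 / 2),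
    (0, 0), (0, 0),
    (3 / 2, √3 / 2), (0, √3), (-3 / 2, √3 / 2), (-3 / 2, -√3 / 2), (0, -√3), (3 / 2, -√3 / 2)]

/-- `S¹, S², S³` pairwise bracket-generate the Lie algebra of split `𝔤₂`: the fourteen elements
form a basis of a Lie subalgebra isomorphic to the split real form `𝔤₂`, in which `h¹` and `h²`
span a Cartan subalgebra, and the elements are root vectors for it according to the root
diagram. -/
structure PairwiseBracketGenerateSplitG2 (S₁ S₂ S₃ : L) : Prop where
  linearIndependent : LinearIndependent ℝ (bracketFamily S₁ S₂ S₃)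
  splitG2 : ∃ 𝔤 : LieSubalgebra ℝ L,
    𝔤.toSubmodule = Submodule.span ℝ (Set.range (bracketFamily S₁ S₂ S₃)) ∧
    Nonempty (𝔤 ≃ₗ⁅ℝ⁆ LieAlgebra.g₂ ℝ) ∧
    ∃ 𝔥 : LieSubalgebra ℝ 𝔤, 𝔥.IsCartanSubalgebra ∧
      𝔥.toSubmodule.map 𝔤.toSubmodule.subtype =
        Submodule.span ℝ {cartanOne S₁ S₂ S₃, cartanTwo S₁ S₂ S₃}
  root_one : ∀ i, ⁅cartanOne S₁ S₂ S₃, bracketFamily S₁ S₂ S₃ i⁆ =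
    (rootDiagram i).1 • bracketFamily S₁ S₂ S₃ i
  root_two : ∀ i, ⁅cartanTwo S₁ S₂ S₃, bracketFamily S₁ S₂ S₃ i⁆ =
    (rootDiagram i).2 • bracketFamily S₁ S₂ S₃ i

end BracketGeneration

/-! ### Maximally symmetric `(2,3,5)`-distributions -/

section Distributions

variable {𝕜 : Type*} [RCLike 𝕜]

/-- The distribution spanned by two vector fields. -/
def spanDist (X₁ X₂ : Coord 𝕜 → Coord 𝕜) (x : Coord 𝕜) : Submodule 𝕜 (Coord 𝕜) :=
  Submodule.span 𝕜 {X₁ x, X₂ x}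

/-- The distribution spanned by `X₁` and `X₂` is a `(2,3,5)`-distribution on `Ω`: it has rank `2`,
its first derived distribution has rank `3`, and its second derived distribution has rank `5`. -/
def Is235 (X₁ X₂ : Coord 𝕜 → Coord 𝕜) (Ω : Set (Coord 𝕜)) : Prop :=
  let X₃ := VectorField.lieBracket 𝕜 X₁ X₂
  ∀ x ∈ Ω,
    Module.finrank 𝕜 (Submodule.span 𝕜 {X₁ x, X₂ x}) = 2 ∧
    Module.finrank 𝕜 (Submodule.span 𝕜 {X₁ x, X₂ x, X₃ x}) = 3 ∧
    Module.finrank 𝕜 (Submodule.span 𝕜 {X₁ x, X₂ x, X₃ x,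
      VectorField.lieBracket 𝕜 X₁ X₃ x, VectorField.lieBracket 𝕜 X₂ X₃ x}) = 5

/-- The flat Cartan distribution on the space with coordinates `(a₁, …, a₅)`, where `aᵢ` is
`a (i - 1)`: the common kernel of
`θ₁ = da₁ + (a₃ + a₄ a₅ / 2) da₄`, `θ₂ = da₂ + (a₃ - a₄ a₅ / 2) da₅` and
`θ₃ = da₃ + a₄ da₅ / 2 - a₅ da₄ / 2`. -/
def flatCartan (a : Coord 𝕜) : Set (Coord 𝕜) :=
  {v | v 0 + (a 2 + a 3 * a 4 / 2) * v 3 = 0 ∧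
    v 1 + (a 2 - a 3 * a 4 / 2) * v 4 = 0 ∧
    v 2 + a 3 / 2 * v 4 - a 4 / 2 * v 3 = 0}

/-- A distribution is maximally symmetric on `Ω` if near every point of `Ω` some local
diffeomorphism maps it onto the flat Cartan distribution. -/
def IsMaximallySymmetric (D : Coord 𝕜 → Submodule 𝕜 (Coord 𝕜)) (Ω : Set (Coord 𝕜)) : Prop :=
  ∀ x ∈ Ω, ∃ e : OpenPartialHomeomorph (Coord 𝕜) (Coord 𝕜),
    x ∈ e.source ∧ e.source ⊆ Ω ∧
    ContDiffOn 𝕜 ∞ e e.source ∧ ContDiffOn 𝕜 ∞ e.symm e.target ∧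
    ∀ u ∈ e.source, fderiv 𝕜 e u '' (D u : Set (Coord 𝕜)) = flatCartan (e u)

end Distributions

/-! ### The explicit data

`α`, `β` are constants, `k` is a non-zero constant and `κ` stands for `√k`, so that
`√(2 / k) = √2 / κ`, `√(2 k) = √2 κ`, `√(2 / k ^ 3) = √2 / κ ^ 3`, `k ^ (3 / 2) = κ ^ 3` and
`√(k / 2) = κ / √2`. -/

section Explicit

variable {𝕜 : Type*} [RCLike 𝕜]

/-- The number `√2`. -/
def sqrtTwo (𝕜 : Type*) [RCLike 𝕜] : 𝕜 := ((√2 : ℝ) : 𝕜)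

/-- `Y = α (2 r³ - 1) + β r (r³ - 2)`. -/
def lameY (α β r : 𝕜) : 𝕜 := α * (2 * r ^ 3 - 1) + β * r * (r ^ 3 - 2)

/-- The domain of the formulas: `r³ + 1 ≠ 0` and `Y ≠ 0`. -/
def lameDomain (α β : 𝕜) : Set (Coord 𝕜) := {x | x 0 ^ 3 + 1 ≠ 0 ∧ lameY α β (x 0) ≠ 0}

/-- The Lamé function `Φ = α (2 r³ - 1) / (r³ + 1)^(4/3) + β r (r³ - 2) / (r³ + 1)^(4/3)`, where
`t` is the chosen cube root of `r³ + 1`. -/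
def lamePhi (α β r t : 𝕜) : 𝕜 :=
  α * ((2 * r ^ 3 - 1) / t ^ 4) + β * (r * (r ^ 3 - 2) / t ^ 4)

/-- `ω₁ = dy - (p / 2) k Φ / (1 + r³)^(2/3) dr`, evaluated at the tangent vector `v` at `x`;
again `t` is the chosen cube root of `r³ + 1`. -/
def lameOmega₁ (α β k t : 𝕜) (x v : Coord 𝕜) : 𝕜 :=
  v 1 - x 3 / 2 * (k * lamePhi α β (x 0) t / t ^ 2) * v 0

/-- `ω₂ = dp - (q / 2) k Φ / (1 + r³)^(2/3) dr`. -/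
def lameOmega₂ (α β k t : 𝕜) (x v : Coord 𝕜) : 𝕜 :=
  v 3 - x 4 / 2 * (k * lamePhi α β (x 0) t / t ^ 2) * v 0

/-- `ω₃ = dz - (q² / 2) k Φ⁴ / (1 + r³)^(2/3) dr`. -/
def lameOmega₃ (α β k t : 𝕜) (x v : Coord 𝕜) : 𝕜 :=
  v 2 - x 4 ^ 2 / 2 * (k * lamePhi α β (x 0) t ^ 4 / t ^ 2) * v 0

/-- `X¹ = ∂_q`. -/
def lameX₁ (_x : Coord 𝕜) : Coord 𝕜 := ![0, 0, 0, 0, 1]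

/-- `X² = 2Y²/(k(r³+1)²) ∂_r + Y³/(r³+1)⁴ p ∂_y + Y³/(r³+1)⁴ q ∂_p + Y⁶/(r³+1)⁸ q² ∂_z`. -/
def lameX₂ (α β k : 𝕜) (x : Coord 𝕜) : Coord 𝕜 :=
  let r := x 0
  let p := x 3
  let q := x 4
  let Y := lameY α β r
  ![2 * Y ^ 2 / (k * (r ^ 3 + 1) ^ 2),
    Y ^ 3 / (r ^ 3 + 1) ^ 4 * p,
    Y ^ 6 / (r ^ 3 + 1) ^ 8 * q ^ 2,
    Y ^ 3 / (r ^ 3 + 1) ^ 4 * q,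
    0]

/-- The function `c₁`. -/
def lameC₁ (α β κ : 𝕜) (x : Coord 𝕜) : 𝕜 :=
  let r := x 0
  let y := x 1
  let p := x 3
  let q := x 4
  let Y := lameY α β r;
  -(3 / 4) * (sqrtTwo 𝕜 / κ ^ 3) * y
    + sqrtTwo 𝕜 / (8 * κ) * (r * (3 * β * r ^ 4 + α * (4 * r ^ 3 + 1)) / (r ^ 3 + 1)) * p
    + sqrtTwo 𝕜 * κ / 16 * (r ^ 2 * Y ^ 2 / (r ^ 3 + 1) ^ 3) * q

/-- The function `c₂`. -/
def lameC₂ (α β k : 𝕜) (x : Coord 𝕜) : 𝕜 :=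
  let r := x 0
  let y := x 1
  let z := x 2
  let p := x 3
  let q := x 4
  let Y := lameY α β r
  6 * z - 288 / k ^ 3 * y ^ 2
    + 8 / k * ((β * (7 * r ^ 4 + 4 * r) + α * (8 * r ^ 3 + 5)) *
        (β * (2 * r ^ 3 - 1) + 3 * α * r ^ 2) / (r ^ 3 + 1) ^ 2) * p ^ 2
    + 3 * k * (r * Y ^ 4 / (r ^ 3 + 1) ^ 6) * q ^ 2
    + 96 / k ^ 2 * ((3 * β * r ^ 4 + α * (4 * r ^ 3 + 1)) * r / (r ^ 3 + 1)) * y * p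
    + 48 / k * (r ^ 2 * Y ^ 2 / (r ^ 3 + 1) ^ 3) * y * q
    + 8 * ((α * (5 * r ^ 3 + 2) + β * (4 * r ^ 4 + r)) * Y ^ 2 / (r ^ 3 + 1) ^ 4) * p * q

/-- The function `c₃`. -/
def lameC₃ (α β κ : 𝕜) (x : Coord 𝕜) : 𝕜 :=
  let r := x 0
  let p := x 3
  let q := x 4
  let Y := lameY α β r;
  -(sqrtTwo 𝕜 / κ) * (β * r + α) * p
    - sqrtTwo 𝕜 * κ / 4 * (r * Y ^ 2 / (r ^ 3 + 1) ^ 3) * q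

/-- The vector field `Z¹`. -/
def lameZ₁ (α β k κ : 𝕜) (x : Coord 𝕜) : Coord 𝕜 :=
  let r := x 0
  let p := x 3
  let q := x 4
  let Y := lameY α β r
  ![0,
    -(sqrtTwo 𝕜 * κ ^ 3 * r / (4 * (r ^ 3 + 1))),
    2 * (sqrtTwo 𝕜 * κ) / (r ^ 3 + 1) ^ 3 * (-(2 * β / k) * (r ^ 3 + 1) ^ 3 * p + Y ^ 2 * q),
    κ / sqrtTwo 𝕜 * ((4 * r ^ 3 + 1) / Y),
    -2 * (sqrtTwo 𝕜 / κ) *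
      ((r ^ 3 + 1) ^ 3 * (6 * α * r ^ 2 + β * (5 * r ^ 3 - 1)) / Y ^ 3)]

/-- The vector field `S¹`. -/
def lameS₁ (α β k : 𝕜) (x : Coord 𝕜) : Coord 𝕜 :=
  let r := x 0
  let y := x 1
  let p := x 3
  let q := x 4
  let Y := lameY α β r
  (24 * (8 * (r ^ 3 + 1) ^ 3 / (k ^ 2 * Y ^ 2) * y
      + 4 * (r ^ 3 + 1) ^ 2 * r * (α + β * r) / (k * Y ^ 2) * p
      + (9 * α * r ^ 2 + β * (r ^ 6 + 8 * r ^ 3 - 2)) / ((r ^ 3 + 1) * Y) * q)) • lameX₁ x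
    - (4 * k * (r ^ 3 + 1) ^ 2 / Y ^ 2) • lameX₂ α β k x

/-- The vector field `S²`. -/
def lameS₂ (α β κ : 𝕜) (x : Coord 𝕜) : Coord 𝕜 :=
  let r := x 0
  let Y := lameY α β r
  (sqrtTwo 𝕜 * (r ^ 3 + 1) ^ 3 / (4 * κ * Y ^ 2)) • lameX₁ x

/-- The vector field `S³ = -c₁ S¹ + c₂ S² - c₃² Z¹`. -/
def lameS₃ (α β k κ : 𝕜) (x : Coord 𝕜) : Coord 𝕜 :=
  -(lameC₁ α β κ x • lameS₁ α β k x) + lameC₂ α β k x • lameS₂ α β κ x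
    - lameC₃ α β κ x ^ 2 • lameZ₁ α β k κ x

end Explicit

end LameG2

end

set_option linter.unusedSimpArgs false

noncomputable section

namespace LameG2

section ChevalleyG2

variable {L : Type*} [LieRing L] [LieAlgebra ℝ L]

/-- The Chevalley–Serre relations of type `G₂`, the root of `e₀` being short. -/
structure ChevalleyG2 (e₀ e₁ f₀ f₁ h₀ h₁ : L) : Prop where
  hh : ⁅h₀, h₁⁆ = 0
  ef₀₀ : ⁅e₀, f₀⁆ = h₀
  ef₁₁ : ⁅e₁, f₁⁆ = h₁
  ef₀₁ : ⁅e₀, f₁⁆ = 0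
  ef₁₀ : ⁅e₁, f₀⁆ = 0
  he₀₀ : ⁅h₀, e₀⁆ = (2 : ℝ) • e₀
  he₀₁ : ⁅h₀, e₁⁆ = (-3 : ℝ) • e₁
  he₁₀ : ⁅h₁, e₀⁆ = (-1 : ℝ) • e₀
  he₁₁ : ⁅h₁, e₁⁆ = (2 : ℝ) • e₁
  hf₀₀ : ⁅h₀, f₀⁆ = (-2 : ℝ) • f₀
  hf₀₁ : ⁅h₀, f₁⁆ = (3 : ℝ) • f₁
  hf₁₀ : ⁅h₁, f₀⁆ = (1 : ℝ) • f₀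
  hf₁₁ : ⁅h₁, f₁⁆ = (-2 : ℝ) • f₁
  serre_e₀ : ⁅e₀, ⁅e₀, ⁅e₀, ⁅e₀, e₁⁆⁆⁆⁆ = 0
  serre_e₁ : ⁅e₁, ⁅e₁, e₀⁆⁆ = 0
  serre_f₀ : ⁅f₀, ⁅f₀, ⁅f₀, ⁅f₀, f₁⁆⁆⁆⁆ = 0
  serre_f₁ : ⁅f₁, ⁅f₁, f₀⁆⁆ = 0

namespace ChevalleyG2

variable {e₀ e₁ f₀ f₁ h₀ h₁ : L}

theorem symm (c : ChevalleyG2 e₀ e₁ f₀ f₁ h₀ h₁) :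
    ChevalleyG2 f₀ f₁ e₀ e₁ (-h₀) (-h₁) where
  hh := by rw [neg_lie, lie_neg, c.hh]; simp
  ef₀₀ := by rw [← lie_skew, c.ef₀₀]
  ef₁₁ := by rw [← lie_skew, c.ef₁₁]
  ef₀₁ := by rw [← lie_skew, c.ef₁₀, neg_zero]
  ef₁₀ := by rw [← lie_skew, c.ef₀₁, neg_zero]
  he₀₀ := by rw [neg_lie, c.hf₀₀]; module
  he₀₁ := by rw [neg_lie, c.hf₀₁]; module
  he₁₀ := by rw [neg_lie, c.hf₁₀]; module
  he₁₁ := by rw [neg_lie, c.hf₁₁]; module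
  hf₀₀ := by rw [neg_lie, c.he₀₀]; module
  hf₀₁ := by rw [neg_lie, c.he₀₁]; module
  hf₁₀ := by rw [neg_lie, c.he₁₀]; module
  hf₁₁ := by rw [neg_lie, c.he₁₁]; module
  serre_e₀ := c.serre_f₀
  serre_e₁ := c.serre_f₁
  serre_f₀ := c.serre_e₀
  serre_f₁ := c.serre_e₁

theorem lie_e₁_e₂ (c : ChevalleyG2 e₀ e₁ f₀ f₁ h₀ h₁) : ⁅e₁, ⁅e₀, e₁⁆⁆ = 0 := by
  have h := c.serre_e₁
  rwa [← lie_skew e₁ e₀, lie_neg, neg_eq_zero] at h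

theorem lie_e₁_e₃ (c : ChevalleyG2 e₀ e₁ f₀ f₁ h₀ h₁) : ⁅e₁, ⁅e₀, ⁅e₀, e₁⁆⁆⁆ = 0 := by
  rw [leibniz_lie, c.lie_e₁_e₂, ← lie_skew e₁ e₀, neg_lie, lie_self]
  simp

theorem lie_e₂_e₃ (c : ChevalleyG2 e₀ e₁ f₀ f₁ h₀ h₁) :
    ⁅⁅e₀, e₁⁆, ⁅e₀, ⁅e₀, e₁⁆⁆⁆ = -⁅e₁, ⁅e₀, ⁅e₀, ⁅e₀, e₁⁆⁆⁆⁆ := by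
  rw [lie_lie, c.lie_e₁_e₃, lie_zero, zero_sub]

theorem lie_e₀_e₅ (c : ChevalleyG2 e₀ e₁ f₀ f₁ h₀ h₁) :
    ⁅e₀, ⁅e₁, ⁅e₀, ⁅e₀, ⁅e₀, e₁⁆⁆⁆⁆⁆ = 0 := by
  have h₁ : ⁅e₀, ⁅e₁, ⁅e₀, ⁅e₀, ⁅e₀, e₁⁆⁆⁆⁆⁆ = ⁅⁅e₀, e₁⁆, ⁅e₀, ⁅e₀, ⁅e₀, e₁⁆⁆⁆⁆ := by
    rw [leibniz_lie, c.serre_e₀, lie_zero, add_zero]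
  have h₂ : ⁅⁅e₀, e₁⁆, ⁅e₀, ⁅e₀, ⁅e₀, e₁⁆⁆⁆⁆ = -⁅e₀, ⁅e₁, ⁅e₀, ⁅e₀, ⁅e₀, e₁⁆⁆⁆⁆⁆ := by
    rw [leibniz_lie ⁅e₀, e₁⁆ e₀, c.lie_e₂_e₃, ← lie_skew ⁅e₀, e₁⁆ e₀, neg_lie, lie_self, lie_neg]
    simp
  have h₃ := h₁.trans h₂
  have h₄ : (2 : ℝ) • ⁅e₀, ⁅e₁, ⁅e₀, ⁅e₀, ⁅e₀, e₁⁆⁆⁆⁆⁆ = 0 := by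
    rw [two_smul]
    exact add_eq_zero_iff_eq_neg.2 h₃
  exact (smul_eq_zero.1 h₄).resolve_left two_ne_zero

theorem lie_e₁_e₅ (c : ChevalleyG2 e₀ e₁ f₀ f₁ h₀ h₁) :
    ⁅e₁, ⁅e₁, ⁅e₀, ⁅e₀, ⁅e₀, e₁⁆⁆⁆⁆⁆ = 0 := by
  have h := c.lie_e₂_e₃
  rw [← neg_eq_iff_eq_neg] at h
  rw [← h, lie_neg, leibniz_lie, c.lie_e₁_e₂, c.lie_e₁_e₃]
  simp

theorem lie_h₀_e₂ (c : ChevalleyG2 e₀ e₁ f₀ f₁ h₀ h₁) :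
    ⁅h₀, ⁅e₀, e₁⁆⁆ = (-1 : ℝ) • ⁅e₀, e₁⁆ := by
  rw [leibniz_lie, c.he₀₀, c.he₀₁, smul_lie, lie_smul]; module

theorem lie_h₀_e₃ (c : ChevalleyG2 e₀ e₁ f₀ f₁ h₀ h₁) :
    ⁅h₀, ⁅e₀, ⁅e₀, e₁⁆⁆⁆ = (1 : ℝ) • ⁅e₀, ⁅e₀, e₁⁆⁆ := by
  rw [leibniz_lie, c.he₀₀, c.lie_h₀_e₂, smul_lie, lie_smul]; module

theorem lie_h₁_e₂ (c : ChevalleyG2 e₀ e₁ f₀ f₁ h₀ h₁) :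
    ⁅h₁, ⁅e₀, e₁⁆⁆ = (1 : ℝ) • ⁅e₀, e₁⁆ := by
  rw [leibniz_lie, c.he₁₀, c.he₁₁, smul_lie, lie_smul]; module

theorem lie_h₁_e₃ (c : ChevalleyG2 e₀ e₁ f₀ f₁ h₀ h₁) :
    ⁅h₁, ⁅e₀, ⁅e₀, e₁⁆⁆⁆ = (0 : ℝ) • ⁅e₀, ⁅e₀, e₁⁆⁆ := by
  rw [leibniz_lie, c.he₁₀, c.lie_h₁_e₂, smul_lie, lie_smul]; module

theorem lie_h₁_e₄ (c : ChevalleyG2 e₀ e₁ f₀ f₁ h₀ h₁) :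
    ⁅h₁, ⁅e₀, ⁅e₀, ⁅e₀, e₁⁆⁆⁆⁆ = (-1 : ℝ) • ⁅e₀, ⁅e₀, ⁅e₀, e₁⁆⁆⁆ := by
  rw [leibniz_lie, c.he₁₀, c.lie_h₁_e₃, smul_lie, lie_smul]; module

theorem lie_f₀_e₂ (c : ChevalleyG2 e₀ e₁ f₀ f₁ h₀ h₁) : ⁅f₀, ⁅e₀, e₁⁆⁆ = (3 : ℝ) • e₁ := by
  rw [leibniz_lie, c.symm.ef₀₀, c.symm.ef₀₁, neg_lie, c.he₀₁, lie_zero]; module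

theorem lie_f₀_e₃ (c : ChevalleyG2 e₀ e₁ f₀ f₁ h₀ h₁) :
    ⁅f₀, ⁅e₀, ⁅e₀, e₁⁆⁆⁆ = (4 : ℝ) • ⁅e₀, e₁⁆ := by
  rw [leibniz_lie, c.symm.ef₀₀, c.lie_f₀_e₂, neg_lie, c.lie_h₀_e₂, lie_smul]; module

theorem lie_f₀_e₄ (c : ChevalleyG2 e₀ e₁ f₀ f₁ h₀ h₁) :
    ⁅f₀, ⁅e₀, ⁅e₀, ⁅e₀, e₁⁆⁆⁆⁆ = (3 : ℝ) • ⁅e₀, ⁅e₀, e₁⁆⁆ := by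
  rw [leibniz_lie, c.symm.ef₀₀, c.lie_f₀_e₃, neg_lie, c.lie_h₀_e₃, lie_smul]; module

theorem lie_f₀_e₅ (c : ChevalleyG2 e₀ e₁ f₀ f₁ h₀ h₁) :
    ⁅f₀, ⁅e₁, ⁅e₀, ⁅e₀, ⁅e₀, e₁⁆⁆⁆⁆⁆ = 0 := by
  rw [leibniz_lie, c.symm.ef₀₁, c.lie_f₀_e₄, zero_lie, lie_smul, c.lie_e₁_e₃]; module

theorem lie_f₁_e₂ (c : ChevalleyG2 e₀ e₁ f₀ f₁ h₀ h₁) : ⁅f₁, ⁅e₀, e₁⁆⁆ = (-1 : ℝ) • e₀ := by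
  rw [leibniz_lie, c.symm.ef₁₀, c.symm.ef₁₁, lie_neg, lie_skew, c.he₁₀, zero_lie]; module

theorem lie_f₁_e₃ (c : ChevalleyG2 e₀ e₁ f₀ f₁ h₀ h₁) : ⁅f₁, ⁅e₀, ⁅e₀, e₁⁆⁆⁆ = 0 := by
  rw [leibniz_lie, c.symm.ef₁₀, c.lie_f₁_e₂, lie_smul, lie_self, zero_lie]; module

theorem lie_f₁_e₄ (c : ChevalleyG2 e₀ e₁ f₀ f₁ h₀ h₁) : ⁅f₁, ⁅e₀, ⁅e₀, ⁅e₀, e₁⁆⁆⁆⁆ = 0 := by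
  rw [leibniz_lie, c.symm.ef₁₀, c.lie_f₁_e₃, lie_zero, zero_lie, add_zero]

theorem lie_f₁_e₅ (c : ChevalleyG2 e₀ e₁ f₀ f₁ h₀ h₁) :
    ⁅f₁, ⁅e₁, ⁅e₀, ⁅e₀, ⁅e₀, e₁⁆⁆⁆⁆⁆ = (1 : ℝ) • ⁅e₀, ⁅e₀, ⁅e₀, e₁⁆⁆⁆ := by
  rw [leibniz_lie, c.symm.ef₁₁, c.lie_f₁_e₄, neg_lie, c.lie_h₁_e₄, lie_zero]; module

/-- The fourteen vectors spanning the Lie algebra generated by the Chevalley generators. -/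
def family (e₀ e₁ f₀ f₁ h₀ h₁ : L) : Fin 14 → L :=
  ![e₀, e₁, ⁅e₀, e₁⁆, ⁅e₀, ⁅e₀, e₁⁆⁆, ⁅e₀, ⁅e₀, ⁅e₀, e₁⁆⁆⁆, ⁅e₁, ⁅e₀, ⁅e₀, ⁅e₀, e₁⁆⁆⁆⁆,
    f₀, f₁, ⁅f₀, f₁⁆, ⁅f₀, ⁅f₀, f₁⁆⁆, ⁅f₀, ⁅f₀, ⁅f₀, f₁⁆⁆⁆, ⁅f₁, ⁅f₀, ⁅f₀, ⁅f₀, f₁⁆⁆⁆⁆, h₀, h₁]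

/-- If a submodule contains the fourteen vectors, then it contains their brackets with `e₀`. -/
theorem lie_e₀_family_mem (c : ChevalleyG2 e₀ e₁ f₀ f₁ h₀ h₁) (i : Fin 14) :
    ⁅e₀, family e₀ e₁ f₀ f₁ h₀ h₁ i⁆ ∈
      Submodule.span ℝ (Set.range (family e₀ e₁ f₀ f₁ h₀ h₁)) := by
  have hm (j : Fin 14) (t : ℝ) : t • family e₀ e₁ f₀ f₁ h₀ h₁ j ∈
      Submodule.span ℝ (Set.range (family e₀ e₁ f₀ f₁ h₀ h₁)) :=
    Submodule.smul_mem _ _ (Submodule.subset_span ⟨j, rfl⟩)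
  fin_cases i
  · convert hm 0 0; simp [family]
  · convert hm 2 1; simp [family]
  · convert hm 3 1; simp [family]
  · convert hm 4 1; simp [family]
  · convert hm 0 0; simp [family, c.serre_e₀]
  · convert hm 0 0; simp [family, c.lie_e₀_e₅]
  · convert hm 12 1; simp [family, c.ef₀₀]
  · convert hm 0 0; simp [family, c.ef₀₁]
  · convert hm 7 3; simp [family, c.symm.lie_f₀_e₂]
  · convert hm 8 4; simp [family, c.symm.lie_f₀_e₃]
  · convert hm 9 3; simp [family, c.symm.lie_f₀_e₄]
  · convert hm 0 0; simp [family, c.symm.lie_f₀_e₅]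
  · convert hm 0 (-2)
    change ⁅e₀, h₀⁆ = (-2 : ℝ) • e₀
    rw [← lie_skew, c.he₀₀]; module
  · convert hm 0 1
    change ⁅e₀, h₁⁆ = (1 : ℝ) • e₀
    rw [← lie_skew, c.he₁₀]; module

theorem lie_e₁_family_mem (c : ChevalleyG2 e₀ e₁ f₀ f₁ h₀ h₁) (i : Fin 14) :
    ⁅e₁, family e₀ e₁ f₀ f₁ h₀ h₁ i⁆ ∈
      Submodule.span ℝ (Set.range (family e₀ e₁ f₀ f₁ h₀ h₁)) := by
  have hm (j : Fin 14) (t : ℝ) : t • family e₀ e₁ f₀ f₁ h₀ h₁ j ∈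
      Submodule.span ℝ (Set.range (family e₀ e₁ f₀ f₁ h₀ h₁)) :=
    Submodule.smul_mem _ _ (Submodule.subset_span ⟨j, rfl⟩)
  fin_cases i
  · convert hm 2 (-1); simp [family]
  · convert hm 0 0; simp [family]
  · convert hm 0 0; simp [family, c.lie_e₁_e₂]
  · convert hm 0 0; simp [family, c.lie_e₁_e₃]
  · convert hm 5 1; simp [family]
  · convert hm 0 0; simp [family, c.lie_e₁_e₅]
  · convert hm 0 0; simp [family, c.ef₁₀]
  · convert hm 13 1; simp [family, c.ef₁₁]
  · convert hm 6 (-1); simp [family, c.symm.lie_f₁_e₂]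
  · convert hm 0 0; simp [family, c.symm.lie_f₁_e₃]
  · convert hm 0 0; simp [family, c.symm.lie_f₁_e₄]
  · convert hm 10 1; simp [family, c.symm.lie_f₁_e₅]
  · convert hm 1 3
    change ⁅e₁, h₀⁆ = (3 : ℝ) • e₁
    rw [← lie_skew, c.he₀₁]; module
  · convert hm 1 (-2)
    change ⁅e₁, h₁⁆ = (-2 : ℝ) • e₁
    rw [← lie_skew, c.he₁₁]; module

theorem span_family_symm :
    Submodule.span ℝ (Set.range (family f₀ f₁ e₀ e₁ (-h₀) (-h₁))) ≤
      Submodule.span ℝ (Set.range (family e₀ e₁ f₀ f₁ h₀ h₁)) := by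
  have hm (j : Fin 14) (t : ℝ) : t • family e₀ e₁ f₀ f₁ h₀ h₁ j ∈
      Submodule.span ℝ (Set.range (family e₀ e₁ f₀ f₁ h₀ h₁)) :=
    Submodule.smul_mem _ _ (Submodule.subset_span ⟨j, rfl⟩)
  rw [Submodule.span_le]
  rintro _ ⟨i, rfl⟩
  have hf : family f₀ f₁ e₀ e₁ (-h₀) (-h₁) i =
      (![1, 1, 1, 1, 1, 1, 1, 1, 1, 1, 1, 1, -1, -1] i : ℝ) • family e₀ e₁ f₀ f₁ h₀ h₁
        (![6, 7, 8, 9, 10, 11, 0, 1, 2, 3, 4, 5, 12, 13] i) := by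
    fin_cases i <;> simp [family]
  rw [hf]
  exact hm _ _

/-- The elements whose bracket preserves a subspace form a Lie subalgebra. -/
def stabilizer (W : Submodule ℝ L) : LieSubalgebra ℝ L where
  carrier := {x | ∀ w ∈ W, ⁅x, w⁆ ∈ W}
  zero_mem' := fun w _ => by simp
  add_mem' := fun {x y} hx hy w hw => by
    rw [add_lie]
    exact W.add_mem (hx w hw) (hy w hw)
  smul_mem' := fun t x hx w hw => by
    rw [smul_lie]
    exact W.smul_mem t (hx w hw)
  lie_mem' := fun {x y} hx hy w hw => by
    rw [lie_lie]
    exact W.sub_mem (hx _ (hy w hw)) (hy _ (hx w hw))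

theorem mem_stabilizer_span {x : L} {ι : Type*} {v : ι → L}
    (h : ∀ i, ⁅x, v i⁆ ∈ Submodule.span ℝ (Set.range v)) :
    x ∈ stabilizer (Submodule.span ℝ (Set.range v)) := by
  intro w hw
  induction hw using Submodule.span_induction with
  | mem y hy => obtain ⟨i, rfl⟩ := hy; exact h i
  | zero => simp
  | add y z _ _ hy hz => rw [lie_add]; exact Submodule.add_mem _ hy hz
  | smul t y _ hy => rw [lie_smul]; exact Submodule.smul_mem _ t hy

theorem span_family_eq_top (c : ChevalleyG2 e₀ e₁ f₀ f₁ h₀ h₁)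
    (hgen : ∀ K : LieSubalgebra ℝ L, e₀ ∈ K → e₁ ∈ K → f₀ ∈ K → f₁ ∈ K → K = ⊤) :
    Submodule.span ℝ (Set.range (family e₀ e₁ f₀ f₁ h₀ h₁)) = ⊤ := by
  set W := Submodule.span ℝ (Set.range (family e₀ e₁ f₀ f₁ h₀ h₁)) with hW
  have hWs : Submodule.span ℝ (Set.range (family f₀ f₁ e₀ e₁ (-h₀) (-h₁))) = W := by
    refine le_antisymm span_family_symm ?_
    simpa using span_family_symm (e₀ := f₀) (e₁ := f₁) (f₀ := e₀) (f₁ := e₁)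
      (h₀ := -h₀) (h₁ := -h₁)
  have hs : stabilizer W = ⊤ := by
    refine hgen _ (mem_stabilizer_span c.lie_e₀_family_mem)
      (mem_stabilizer_span c.lie_e₁_family_mem) ?_ ?_
    · rw [← hWs]; exact mem_stabilizer_span c.symm.lie_e₀_family_mem
    · rw [← hWs]; exact mem_stabilizer_span c.symm.lie_e₁_family_mem
  let K : LieSubalgebra ℝ L :=
    { W with
      lie_mem' := fun {x y} _ hy => by
        have hx : x ∈ stabilizer W := by rw [hs]; trivial
        exact hx y hy }
  have hK : K = ⊤ := hgen K (Submodule.subset_span ⟨0, rfl⟩) (Submodule.subset_span ⟨1, rfl⟩)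
    (Submodule.subset_span ⟨6, rfl⟩) (Submodule.subset_span ⟨7, rfl⟩)
  exact congrArg LieSubalgebra.toSubmodule hK

end ChevalleyG2

/-! ### The Lie algebra `𝔤₂` of Mathlib -/

namespace SerreG2

open CartanMatrix

/-- The generators of the Serre presentation of `𝔤₂`. -/
def gen (g : Generators (Fin 2)) : LieAlgebra.g₂ ℝ :=
  LieSubmodule.Quotient.mk (FreeLieAlgebra.of ℝ g)

theorem mk_eq_zero {x : FreeLieAlgebra ℝ (Generators (Fin 2))}
    (hx : x ∈ Relations.toSet ℝ CartanMatrix.G₂) :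
    (LieSubmodule.Quotient.mk (N := Relations.toIdeal ℝ CartanMatrix.G₂) x) = 0 :=
  LieSubmodule.Quotient.mk_eq_zero'.2 (LieSubmodule.subset_lieSpan hx)

/-- A Lie algebra homomorphism from the free Lie algebra that kills the Serre relations factors
through `𝔤₂`. -/
def lift (F : FreeLieAlgebra ℝ (Generators (Fin 2)) →ₗ⁅ℝ⁆ L)
    (hF : ∀ x ∈ Relations.toSet ℝ CartanMatrix.G₂, F x = 0) : LieAlgebra.g₂ ℝ →ₗ⁅ℝ⁆ L :=
  let h : Relations.toIdeal ℝ CartanMatrix.G₂ ≤ F.ker :=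
    LieSubmodule.lieSpan_le.2 fun x hx => LieHom.mem_ker.2 (hF x hx)
  { (Relations.toIdeal ℝ CartanMatrix.G₂).toSubmodule.liftQ (F : _ →ₗ[ℝ] L)
      (fun _ hx => LinearMap.mem_ker.2 (LieHom.mem_ker.1 (h hx))) with
    map_lie' := fun {x y} => by
      induction x using Submodule.Quotient.induction_on with | _ x =>
      induction y using Submodule.Quotient.induction_on with | _ y =>
      exact F.map_lie x y }

theorem lift_gen (F : FreeLieAlgebra ℝ (Generators (Fin 2)) →ₗ⁅ℝ⁆ L)
    (hF : ∀ x ∈ Relations.toSet ℝ CartanMatrix.G₂, F x = 0) (g : Generators (Fin 2)) :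
    lift F hF (gen g) = F (FreeLieAlgebra.of ℝ g) := rfl

theorem range_gen_generates (K : LieSubalgebra ℝ (LieAlgebra.g₂ ℝ)) (hK : ∀ g, gen g ∈ K) :
    K = ⊤ := by
  let π : FreeLieAlgebra ℝ (Generators (Fin 2)) →ₗ⁅ℝ⁆ LieAlgebra.g₂ ℝ :=
    { (Relations.toIdeal ℝ CartanMatrix.G₂).toSubmodule.mkQ with map_lie' := fun {_ _} => rfl }
  let F : FreeLieAlgebra ℝ (Generators (Fin 2)) →ₗ⁅ℝ⁆ K :=
    FreeLieAlgebra.lift ℝ fun g => ⟨gen g, hK g⟩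
  have h : K.incl.comp F = π := by
    apply FreeLieAlgebra.hom_ext
    intro g
    simp only [LieHom.comp_apply, F, FreeLieAlgebra.lift_of_apply]
    rfl
  rw [eq_top_iff]
  intro x _
  induction x using Submodule.Quotient.induction_on with | _ x =>
  change π x ∈ K
  rw [← h]
  exact (F x).2

theorem chevalley_gen : ChevalleyG2 (gen (.E 0)) (gen (.E 1)) (gen (.F 0)) (gen (.F 1))
    (gen (.H 0)) (gen (.H 1)) := by
  have hHH (i j : Fin 2) : ⁅gen (.H i), gen (.H j)⁆ = 0 :=
    mk_eq_zero (.inl (.inl (.inl (.inl (.inl ⟨(i, j), rfl⟩)))))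
  have hEF (i : Fin 2) : ⁅gen (.E i), gen (.F i)⁆ = gen (.H i) := by
    have h := mk_eq_zero (.inl (.inl (.inl (.inl (.inr ⟨(i, i), rfl⟩)))))
    simp only [Relations.EF, Function.uncurry, if_true] at h
    exact sub_eq_zero.1 h
  have hEF' (i j : Fin 2) (hij : i ≠ j) : ⁅gen (.E i), gen (.F j)⁆ = 0 := by
    have h := mk_eq_zero (.inl (.inl (.inl (.inl (.inr ⟨(i, j), rfl⟩)))))
    simp only [Relations.EF, Function.uncurry, hij, if_false] at h
    exact h
  have hHE (i j : Fin 2) :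
      ⁅gen (.H i), gen (.E j)⁆ = ((CartanMatrix.G₂ i j : ℤ) : ℝ) • gen (.E j) := by
    have h := mk_eq_zero (.inl (.inl (.inl (.inr ⟨(i, j), rfl⟩))))
    rw [Int.cast_smul_eq_zsmul]
    exact sub_eq_zero.1 h
  have hHF (i j : Fin 2) :
      ⁅gen (.H i), gen (.F j)⁆ = ((-CartanMatrix.G₂ i j : ℤ) : ℝ) • gen (.F j) := by
    have h := mk_eq_zero (.inl (.inl (.inr ⟨(i, j), rfl⟩)))
    rw [Int.cast_smul_eq_zsmul, neg_smul]
    exact eq_neg_of_add_eq_zero_left h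
  exact
    { hh := hHH 0 1
      ef₀₀ := hEF 0
      ef₁₁ := hEF 1
      ef₀₁ := hEF' 0 1 (by decide)
      ef₁₀ := hEF' 1 0 (by decide)
      he₀₀ := by rw [hHE]; simp [CartanMatrix.G₂]
      he₀₁ := by rw [hHE]; simp [CartanMatrix.G₂]
      he₁₀ := by rw [hHE]; simp [CartanMatrix.G₂]
      he₁₁ := by rw [hHE]; simp [CartanMatrix.G₂]
      hf₀₀ := by rw [hHF]; simp [CartanMatrix.G₂]
      hf₀₁ := by rw [hHF]; simp [CartanMatrix.G₂]
      hf₁₀ := by rw [hHF]; simp [CartanMatrix.G₂]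
      hf₁₁ := by rw [hHF]; simp [CartanMatrix.G₂]
      serre_e₀ := mk_eq_zero (.inl (.inr ⟨(0, 1), rfl⟩))
      serre_e₁ := mk_eq_zero (.inl (.inr ⟨(1, 0), rfl⟩))
      serre_f₀ := mk_eq_zero (.inr ⟨(0, 1), rfl⟩)
      serre_f₁ := mk_eq_zero (.inr ⟨(1, 0), rfl⟩) }

theorem span_family_eq_top :
    Submodule.span ℝ (Set.range (ChevalleyG2.family (gen (.E 0)) (gen (.E 1)) (gen (.F 0))
      (gen (.F 1)) (gen (.H 0)) (gen (.H 1)))) = ⊤ := by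
  refine chevalley_gen.span_family_eq_top fun K h₁ h₂ h₃ h₄ => range_gen_generates K fun g => ?_
  rcases g with i | i | i
  · fin_cases i
    · exact chevalley_gen.ef₀₀ ▸ K.lie_mem h₁ h₃
    · exact chevalley_gen.ef₁₁ ▸ K.lie_mem h₂ h₄
  · fin_cases i
    · exact h₁
    · exact h₂
  · fin_cases i
    · exact h₃
    · exact h₄

instance : Module.Finite ℝ (LieAlgebra.g₂ ℝ) :=
  ⟨⟨(Set.finite_range _).toFinset, by rw [Set.Finite.coe_toFinset]; exact span_family_eq_top⟩⟩

theorem finrank_le : Module.finrank ℝ (LieAlgebra.g₂ ℝ) ≤ 14 := by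
  rw [← finrank_top, ← span_family_eq_top]
  exact (finrank_range_le_card _).trans (by simp)

/-- The homomorphism from `𝔤₂` determined by elements satisfying the Chevalley–Serre relations. -/
theorem exists_hom {e₀ e₁ f₀ f₁ h₀ h₁ : L} (c : ChevalleyG2 e₀ e₁ f₀ f₁ h₀ h₁) :
    ∃ F : LieAlgebra.g₂ ℝ →ₗ⁅ℝ⁆ L, F (gen (.E 0)) = e₀ ∧ F (gen (.E 1)) = e₁ ∧
      F (gen (.F 0)) = f₀ ∧ F (gen (.F 1)) = f₁ := by
  let v : Generators (Fin 2) → L := fun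
    | .E i => ![e₀, e₁] i
    | .F i => ![f₀, f₁] i
    | .H i => ![h₀, h₁] i
  have key : ∀ x ∈ Relations.toSet ℝ CartanMatrix.G₂, FreeLieAlgebra.lift ℝ v x = 0 := by
    rintro x (((((⟨⟨i, j⟩, rfl⟩ | ⟨⟨i, j⟩, rfl⟩) | ⟨⟨i, j⟩, rfl⟩) | ⟨⟨i, j⟩, rfl⟩) | ⟨⟨i, j⟩, rfl⟩) |
      ⟨⟨i, j⟩, rfl⟩)
    · have h := c.symm.hh
      fin_cases i <;> fin_cases j <;>
        simp [Relations.HH, v, c.hh, ← lie_skew h₁ h₀]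
    · fin_cases i <;> fin_cases j <;>
        simp [Relations.EF, v, c.ef₀₀, c.ef₀₁, c.ef₁₀, c.ef₁₁]
    · fin_cases i <;> fin_cases j <;>
        simp [Relations.HE, v, c.he₀₀, c.he₀₁, c.he₁₀, c.he₁₁, CartanMatrix.G₂,
          ← Int.cast_smul_eq_zsmul ℝ]
    · fin_cases i <;> fin_cases j <;>
        simp [Relations.HF, v, c.hf₀₀, c.hf₀₁, c.hf₁₀, c.hf₁₁, CartanMatrix.G₂,
          ← Int.cast_smul_eq_zsmul ℝ]
    · fin_cases i <;> fin_cases j <;>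
        simp [Relations.adE, v, c.serre_e₀, c.serre_e₁, CartanMatrix.G₂, pow_succ]
    · fin_cases i <;> fin_cases j <;>
        simp [Relations.adF, v, c.serre_f₀, c.serre_f₁, CartanMatrix.G₂, pow_succ]
  refine ⟨lift _ key, ?_, ?_, ?_, ?_⟩ <;> rw [lift_gen, FreeLieAlgebra.lift_of_apply] <;> rfl

end SerreG2

end ChevalleyG2

section ShortRoots

variable {L : Type*} [LieRing L] [LieAlgebra ℝ L]

/-- Relations between three elements `S₁`, `S₂`, `S₃` which make them root vectors of `𝔤₂` for
three short roots with sum zero. -/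
structure ShortRootRelations (S₁ S₂ S₃ : L) : Prop where
  h_S₁ : ⁅⁅⁅S₁, S₂⁆, S₃⁆, S₁⁆ = (2 : ℝ) • S₁
  h_S₂ : ⁅⁅⁅S₁, S₂⁆, S₃⁆, S₂⁆ = (2 : ℝ) • S₂
  h_S₃ : ⁅⁅⁅S₁, S₂⁆, S₃⁆, S₃⁆ = (-4 : ℝ) • S₃
  H_S₁ : ⁅⁅S₂, ⁅S₃, S₁⁆⁆, S₁⁆ = (-2 : ℝ) • S₁
  H_S₂ : ⁅⁅S₂, ⁅S₃, S₁⁆⁆, S₂⁆ = (4 : ℝ) • S₂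
  H_S₃ : ⁅⁅S₂, ⁅S₃, S₁⁆⁆, S₃⁆ = (-2 : ℝ) • S₃
  S₁_L₁ : ⁅S₁, ⁅S₁, ⁅S₁, S₂⁆⁆⁆ = 0
  S₁_L₆ : ⁅S₁, ⁅S₁, ⁅S₃, S₁⁆⁆⁆ = 0
  S₁_L₃ : ⁅S₁, ⁅S₂, ⁅S₂, S₃⁆⁆⁆ = (-6 : ℝ) • S₂
  S₂_L₃ : ⁅S₂, ⁅S₂, ⁅S₂, S₃⁆⁆⁆ = 0
  S₅_L₃ : ⁅⁅S₂, S₃⁆, ⁅S₂, ⁅S₂, S₃⁆⁆⁆ = 0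
  S₅_L₄ : ⁅⁅S₂, S₃⁆, ⁅S₃, ⁅S₂, S₃⁆⁆⁆ = 0
  S₅_L₆ : ⁅⁅S₂, S₃⁆, ⁅S₁, ⁅S₃, S₁⁆⁆⁆ = (6 : ℝ) • ⁅S₃, S₁⁆
  S₅_S₆ : ⁅⁅S₂, S₃⁆, ⁅S₃, S₁⁆⁆ = (-8 : ℝ) • S₃
  S₆_L₆ : ⁅⁅S₃, S₁⁆, ⁅S₁, ⁅S₃, S₁⁆⁆⁆ = 0
  L₃_L₆ : ⁅⁅S₂, ⁅S₂, S₃⁆⁆, ⁅S₁, ⁅S₃, S₁⁆⁆⁆ =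
    (-6 : ℝ) • ⁅⁅S₁, S₂⁆, S₃⁆ + (12 : ℝ) • ⁅S₂, ⁅S₃, S₁⁆⁆

theorem lie_weight {h x y : L} {a b c : ℝ} (hx : ⁅h, x⁆ = a • x) (hy : ⁅h, y⁆ = b • y)
    (hc : c = a + b) : ⁅h, ⁅x, y⁆⁆ = c • ⁅x, y⁆ := by
  rw [hc, leibniz_lie, hx, hy, smul_lie, lie_smul, add_smul]

namespace ShortRootRelations

variable {S₁ S₂ S₃ : L}

theorem map (r : ShortRootRelations S₁ S₂ S₃) {L' : Type*} [LieRing L'] [LieAlgebra ℝ L']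
    (f : L →ₗ⁅ℝ⁆ L') : ShortRootRelations (f S₁) (f S₂) (f S₃) where
  h_S₁ := by simpa only [LieHom.map_lie, map_smul, map_add, map_zero] using congrArg f r.h_S₁
  h_S₂ := by simpa only [LieHom.map_lie, map_smul, map_add, map_zero] using congrArg f r.h_S₂
  h_S₃ := by simpa only [LieHom.map_lie, map_smul, map_add, map_zero] using congrArg f r.h_S₃
  H_S₁ := by simpa only [LieHom.map_lie, map_smul, map_add, map_zero] using congrArg f r.H_S₁
  H_S₂ := by simpa only [LieHom.map_lie, map_smul, map_add, map_zero] using congrArg f r.H_S₂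
  H_S₃ := by simpa only [LieHom.map_lie, map_smul, map_add, map_zero] using congrArg f r.H_S₃
  S₁_L₁ := by simpa only [LieHom.map_lie, map_smul, map_add, map_zero] using congrArg f r.S₁_L₁
  S₁_L₆ := by simpa only [LieHom.map_lie, map_smul, map_add, map_zero] using congrArg f r.S₁_L₆
  S₁_L₃ := by simpa only [LieHom.map_lie, map_smul, map_add, map_zero] using congrArg f r.S₁_L₃
  S₂_L₃ := by simpa only [LieHom.map_lie, map_smul, map_add, map_zero] using congrArg f r.S₂_L₃
  S₅_L₃ := by simpa only [LieHom.map_lie, map_smul, map_add, map_zero] using congrArg f r.S₅_L₃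
  S₅_L₄ := by simpa only [LieHom.map_lie, map_smul, map_add, map_zero] using congrArg f r.S₅_L₄
  S₅_L₆ := by simpa only [LieHom.map_lie, map_smul, map_add, map_zero] using congrArg f r.S₅_L₆
  S₅_S₆ := by simpa only [LieHom.map_lie, map_smul, map_add, map_zero] using congrArg f r.S₅_S₆
  S₆_L₆ := by simpa only [LieHom.map_lie, map_smul, map_add, map_zero] using congrArg f r.S₆_L₆
  L₃_L₆ := by simpa only [LieHom.map_lie, map_smul, map_add, map_zero] using congrArg f r.L₃_L₆

theorem h_H (r : ShortRootRelations S₁ S₂ S₃) : ⁅⁅⁅S₁, S₂⁆, S₃⁆, ⁅S₂, ⁅S₃, S₁⁆⁆⁆ = 0 := by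
  rw [lie_weight r.h_S₂ (lie_weight r.h_S₃ r.h_S₁ rfl) (c := 0) (by norm_num), zero_smul]

/-- Weights of the fourteen elements under `h` and `H`. -/
theorem h_family (r : ShortRootRelations S₁ S₂ S₃) (i : Fin 14) :
    ⁅⁅⁅S₁, S₂⁆, S₃⁆, bracketFamily S₁ S₂ S₃ i⁆ =
      (![2, 2, -4, 4, -2, -2, 0, 0, 6, 6, 0, -6, -6, 0] i : ℝ) • bracketFamily S₁ S₂ S₃ i := by
  have h₁ := r.h_S₁
  have h₂ := r.h_S₂
  have h₃ := r.h_S₃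
  have h₄ := lie_weight (c := 4) h₁ h₂ (by norm_num)
  have h₅ := lie_weight (c := -2) h₂ h₃ (by norm_num)
  have h₆ := lie_weight (c := -2) h₃ h₁ (by norm_num)
  fin_cases i
  · exact h₁
  · exact h₂
  · exact h₃
  · exact h₄
  · exact h₅
  · exact h₆
  · change ⁅_, cartanOne S₁ S₂ S₃⁆ = (0 : ℝ) • _
    rw [cartanOne, lie_smul, lie_sub, r.h_H, lie_self, sub_zero, smul_zero, zero_smul]
  · change ⁅_, cartanTwo S₁ S₂ S₃⁆ = (0 : ℝ) • _
    rw [cartanTwo, lie_smul, lie_add, r.h_H, lie_self, add_zero, smul_zero, zero_smul]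
  · exact lie_weight h₁ h₄ (by norm_num)
  · exact lie_weight h₂ h₄ (by norm_num)
  · exact lie_weight h₂ h₅ (by norm_num)
  · exact lie_weight h₃ h₅ (by norm_num)
  · exact lie_weight h₃ h₆ (by norm_num)
  · exact lie_weight h₁ h₆ (by norm_num)

theorem H_family (r : ShortRootRelations S₁ S₂ S₃) (i : Fin 14) :
    ⁅⁅S₂, ⁅S₃, S₁⁆⁆, bracketFamily S₁ S₂ S₃ i⁆ =
      (![-2, 4, -2, 2, 2, -4, 0, 0, 0, 6, 6, 0, -6, -6] i : ℝ) • bracketFamily S₁ S₂ S₃ i := by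
  have h₁ := r.H_S₁
  have h₂ := r.H_S₂
  have h₃ := r.H_S₃
  have h₄ := lie_weight (c := 2) h₁ h₂ (by norm_num)
  have h₅ := lie_weight (c := 2) h₂ h₃ (by norm_num)
  have h₆ := lie_weight (c := -4) h₃ h₁ (by norm_num)
  have hH : ⁅⁅S₂, ⁅S₃, S₁⁆⁆, ⁅⁅S₁, S₂⁆, S₃⁆⁆ = 0 := by rw [← lie_skew, r.h_H, neg_zero]
  fin_cases i
  · exact h₁
  · exact h₂
  · exact h₃
  · exact h₄
  · exact h₅
  · exact h₆
  · change ⁅_, cartanOne S₁ S₂ S₃⁆ = (0 : ℝ) • _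
    rw [cartanOne, lie_smul, lie_sub, hH, lie_self, sub_zero, smul_zero, zero_smul]
  · change ⁅_, cartanTwo S₁ S₂ S₃⁆ = (0 : ℝ) • _
    rw [cartanTwo, lie_smul, lie_add, hH, lie_self, add_zero, smul_zero, zero_smul]
  · exact lie_weight h₁ h₄ (by norm_num)
  · exact lie_weight h₂ h₄ (by norm_num)
  · exact lie_weight h₂ h₅ (by norm_num)
  · exact lie_weight h₃ h₅ (by norm_num)
  · exact lie_weight h₃ h₆ (by norm_num)
  · exact lie_weight h₁ h₆ (by norm_num)

theorem root_one (r : ShortRootRelations S₁ S₂ S₃) (i : Fin 14) :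
    ⁅cartanOne S₁ S₂ S₃, bracketFamily S₁ S₂ S₃ i⁆ =
      (rootDiagram i).1 • bracketFamily S₁ S₂ S₃ i := by
  rw [cartanOne, smul_lie, sub_lie, r.h_family, r.H_family, ← sub_smul, smul_smul]
  congr 1
  fin_cases i <;> simp [rootDiagram] <;> norm_num

theorem root_two (r : ShortRootRelations S₁ S₂ S₃) (i : Fin 14) :
    ⁅cartanTwo S₁ S₂ S₃, bracketFamily S₁ S₂ S₃ i⁆ =
      (rootDiagram i).2 • bracketFamily S₁ S₂ S₃ i := by
  rw [cartanTwo, smul_lie, add_lie, r.h_family, r.H_family, ← add_smul, smul_smul]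
  congr 1
  fin_cases i <;> simp [rootDiagram] <;> ring

theorem chevalley (r : ShortRootRelations S₁ S₂ S₃) :
    ChevalleyG2 S₁ ⁅S₂, ⁅S₂, S₃⁆⁆ ((1 / 2 : ℝ) • ⁅S₂, S₃⁆) ((1 / 36 : ℝ) • ⁅S₁, ⁅S₃, S₁⁆⁆)
      ((1 / 2 : ℝ) • (⁅⁅S₁, S₂⁆, S₃⁆ - ⁅S₂, ⁅S₃, S₁⁆⁆))
      ((1 / 6 : ℝ) • ((2 : ℝ) • ⁅S₂, ⁅S₃, S₁⁆⁆ - ⁅⁅S₁, S₂⁆, S₃⁆)) := by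
  have hH : ⁅⁅S₂, ⁅S₃, S₁⁆⁆, ⁅⁅S₁, S₂⁆, S₃⁆⁆ = 0 := by rw [← lie_skew, r.h_H, neg_zero]
  have h₁ : ⁅_, S₁⁆ = _ := r.h_family 0
  have h₃ : ⁅_, ⁅S₂, ⁅S₂, S₃⁆⁆⁆ = _ := r.h_family 10
  have h₅ : ⁅_, ⁅S₂, S₃⁆⁆ = _ := r.h_family 4
  have h₆ : ⁅_, ⁅S₁, ⁅S₃, S₁⁆⁆⁆ = _ := r.h_family 13
  have H₁ : ⁅_, S₁⁆ = _ := r.H_family 0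
  have H₃ : ⁅_, ⁅S₂, ⁅S₂, S₃⁆⁆⁆ = _ := r.H_family 10
  have H₅ : ⁅_, ⁅S₂, S₃⁆⁆ = _ := r.H_family 4
  have H₆ : ⁅_, ⁅S₁, ⁅S₃, S₁⁆⁆⁆ = _ := r.H_family 13
  simp only [bracketFamily, Matrix.cons_val] at h₁ h₃ h₅ h₆ H₁ H₃ H₅ H₆
  have hL₃S₁ : ⁅⁅S₂, ⁅S₂, S₃⁆⁆, S₁⁆ = (6 : ℝ) • S₂ := by rw [← lie_skew, r.S₁_L₃]; module
  have hL₃S₂ : ⁅⁅S₂, ⁅S₂, S₃⁆⁆, S₂⁆ = 0 := by rw [← lie_skew, r.S₂_L₃, neg_zero]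
  have hL₃S₅ : ⁅⁅S₂, ⁅S₂, S₃⁆⁆, ⁅S₂, S₃⁆⁆ = 0 := by rw [← lie_skew, r.S₅_L₃, neg_zero]
  have hS₅S₃ : ⁅⁅S₂, S₃⁆, S₃⁆ = -⁅S₃, ⁅S₂, S₃⁆⁆ := (lie_skew _ _).symm
  have hL₆S₅ : ⁅⁅S₁, ⁅S₃, S₁⁆⁆, ⁅S₂, S₃⁆⁆ = (-6 : ℝ) • ⁅S₃, S₁⁆ := by
    rw [← lie_skew, r.S₅_L₆]; module
  have hL₆S₆ : ⁅⁅S₁, ⁅S₃, S₁⁆⁆, ⁅S₃, S₁⁆⁆ = 0 := by rw [← lie_skew, r.S₆_L₆, neg_zero]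
  constructor
  · simp only [smul_lie, lie_smul, sub_lie, lie_sub, lie_self, hH, r.h_H]; module
  · rw [lie_smul, leibniz_lie, ← lie_skew S₁ S₃, lie_neg, sub_eq_add_neg]
  · rw [lie_smul, r.L₃_L₆]; module
  · rw [lie_smul, r.S₁_L₆, smul_zero]
  · rw [lie_smul, hL₃S₅, smul_zero]
  · rw [smul_lie, sub_lie, h₁, H₁]; module
  · rw [smul_lie, sub_lie, h₃, H₃]; module
  · rw [smul_lie, sub_lie, smul_lie, h₁, H₁]; module
  · rw [smul_lie, sub_lie, smul_lie, h₃, H₃]; module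
  · rw [smul_lie, sub_lie, lie_smul, lie_smul, h₅, H₅]; module
  · rw [smul_lie, sub_lie, lie_smul, lie_smul, h₆, H₆]; module
  · rw [smul_lie, sub_lie, smul_lie, lie_smul, lie_smul, h₅, H₅]; module
  · rw [smul_lie, sub_lie, smul_lie, lie_smul, lie_smul, h₆, H₆]; module
  · simp only [r.S₁_L₃, lie_smul, r.S₁_L₁, smul_zero]
  · rw [hL₃S₁, lie_smul, hL₃S₂, smul_zero]
  · simp only [smul_lie, lie_smul, r.S₅_L₆, r.S₅_S₆, hS₅S₃, lie_neg, r.S₅_L₄, neg_zero, smul_zero]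
  · simp only [smul_lie, lie_smul, hL₆S₅, hL₆S₆, smul_zero]

theorem exists_range (r : ShortRootRelations S₁ S₂ S₃)
    (hli : LinearIndependent ℝ (bracketFamily S₁ S₂ S₃)) :
    ∃ 𝔤 : LieSubalgebra ℝ L,
      𝔤.toSubmodule = Submodule.span ℝ (Set.range (bracketFamily S₁ S₂ S₃)) ∧
      Nonempty (𝔤 ≃ₗ⁅ℝ⁆ LieAlgebra.g₂ ℝ) := by
  obtain ⟨F, he₀, he₁, hf₀, hf₁⟩ := SerreG2.exists_hom r.chevalley
  have m₁ : S₁ ∈ F.range := ⟨_, he₀⟩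
  have mL₃ : ⁅S₂, ⁅S₂, S₃⁆⁆ ∈ F.range := ⟨_, he₁⟩
  have m₂ : S₂ ∈ F.range := by
    have h := F.range.smul_mem (-1 / 6 : ℝ) (F.range.lie_mem m₁ mL₃)
    rw [r.S₁_L₃, smul_smul] at h
    norm_num at h
    simpa using h
  have m₅ : ⁅S₂, S₃⁆ ∈ F.range := by
    have h := F.range.smul_mem (2 : ℝ) (⟨_, hf₀⟩ : (1 / 2 : ℝ) • ⁅S₂, S₃⁆ ∈ F.range)
    rw [smul_smul] at h
    norm_num at h
    simpa using h
  have mL₆ : ⁅S₁, ⁅S₃, S₁⁆⁆ ∈ F.range := by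
    have h := F.range.smul_mem (36 : ℝ) (⟨_, hf₁⟩ : (1 / 36 : ℝ) • ⁅S₁, ⁅S₃, S₁⁆⁆ ∈ F.range)
    rw [smul_smul] at h
    norm_num at h
    simpa using h
  have m₆ : ⁅S₃, S₁⁆ ∈ F.range := by
    have h := F.range.smul_mem (1 / 6 : ℝ) (F.range.lie_mem m₅ mL₆)
    rw [r.S₅_L₆, smul_smul] at h
    norm_num at h
    simpa using h
  have m₃ : S₃ ∈ F.range := by
    have h := F.range.smul_mem (-1 / 8 : ℝ) (F.range.lie_mem m₅ m₆)
    rw [r.S₅_S₆, smul_smul] at h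
    norm_num at h
    simpa using h
  have m₄ := F.range.lie_mem m₁ m₂
  have mh := F.range.lie_mem m₄ m₃
  have mH := F.range.lie_mem m₂ m₆
  have hle : Submodule.span ℝ (Set.range (bracketFamily S₁ S₂ S₃)) ≤ F.range.toSubmodule := by
    rw [Submodule.span_le]
    rintro _ ⟨i, rfl⟩
    fin_cases i
    · exact m₁
    · exact m₂
    · exact m₃
    · exact m₄
    · exact m₅
    · exact m₆
    · exact F.range.smul_mem _ (F.range.sub_mem mh mH)
    · exact F.range.smul_mem _ (F.range.add_mem mh mH)
    · exact F.range.lie_mem m₁ m₄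
    · exact F.range.lie_mem m₂ m₄
    · exact F.range.lie_mem m₂ m₅
    · exact F.range.lie_mem m₃ m₅
    · exact F.range.lie_mem m₃ m₆
    · exact F.range.lie_mem m₁ m₆
  have hdim : Module.finrank ℝ (Submodule.span ℝ (Set.range (bracketFamily S₁ S₂ S₃))) = 14 := by
    rw [finrank_span_eq_card hli, Fintype.card_fin]
  have hr : F.range.toSubmodule = LinearMap.range (F : LieAlgebra.g₂ ℝ →ₗ[ℝ] L) := rfl
  rw [hr] at hle
  have h₁ := Submodule.finrank_mono hle
  have h₂ := LinearMap.finrank_range_add_finrank_ker (F : LieAlgebra.g₂ ℝ →ₗ[ℝ] L)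
  have h₃ := SerreG2.finrank_le
  have hker : LinearMap.ker (F : LieAlgebra.g₂ ℝ →ₗ[ℝ] L) = ⊥ :=
    Submodule.finrank_eq_zero.1 (by omega)
  refine ⟨F.range, (Submodule.eq_of_le_of_finrank_le hle (by omega)).symm, ⟨?_⟩⟩
  exact (LieEquiv.ofInjective F (LinearMap.ker_eq_bot.1 hker)).symm

theorem cartanOne_eq_family : cartanOne S₁ S₂ S₃ = bracketFamily S₁ S₂ S₃ 6 := rfl

theorem cartanTwo_eq_family : cartanTwo S₁ S₂ S₃ = bracketFamily S₁ S₂ S₃ 7 := rfl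

theorem lie_cartan (r : ShortRootRelations S₁ S₂ S₃) :
    ⁅cartanOne S₁ S₂ S₃, cartanTwo S₁ S₂ S₃⁆ = 0 := by
  have h := r.root_one 7
  rw [← cartanTwo_eq_family] at h
  simpa [rootDiagram] using h

/-- The commutator with a combination of root vectors, in coordinates. -/
theorem coeff_eq_zero_of_lie_mem (hli : LinearIndependent ℝ (bracketFamily S₁ S₂ S₃)) {x : L}
    {ρ c : Fin 14 → ℝ} (hx : ⁅x, ∑ i, c i • bracketFamily S₁ S₂ S₃ i⁆ ∈
      Submodule.span ℝ {cartanOne S₁ S₂ S₃, cartanTwo S₁ S₂ S₃})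
    (hρ : ∀ i, ⁅x, bracketFamily S₁ S₂ S₃ i⁆ = ρ i • bracketFamily S₁ S₂ S₃ i)
    (i : Fin 14) (h₆ : i ≠ 6) (h₇ : i ≠ 7) : c i * ρ i = 0 := by
  obtain ⟨a, b, hab⟩ := Submodule.mem_span_pair.1 hx
  have h : ∑ j, (c j * ρ j - (if j = 6 then a else 0) - (if j = 7 then b else 0)) •
      bracketFamily S₁ S₂ S₃ j = 0 := by
    simp only [sub_smul, Finset.sum_sub_distrib, ite_smul, zero_smul, Finset.sum_ite_eq',
      Finset.mem_univ, if_true]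
    rw [← cartanOne_eq_family, ← cartanTwo_eq_family, sub_sub, hab, lie_sum, sub_eq_zero]
    exact Finset.sum_congr rfl fun j _ => by rw [lie_smul, hρ, smul_smul]
  have h' := Fintype.linearIndependent_iff.1 hli _ h i
  simpa [h₆, h₇] using h'

theorem pairwiseBracketGenerate (r : ShortRootRelations S₁ S₂ S₃)
    (hli : LinearIndependent ℝ (bracketFamily S₁ S₂ S₃)) :
    PairwiseBracketGenerateSplitG2 S₁ S₂ S₃ := by
  obtain ⟨𝔤, h𝔤, hiso⟩ := r.exists_range hli
  refine ⟨hli, ⟨𝔤, h𝔤, hiso, ?_⟩, r.root_one, r.root_two⟩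
  set C := Submodule.span ℝ {cartanOne S₁ S₂ S₃, cartanTwo S₁ S₂ S₃} with hC
  have hmem : ∀ i, bracketFamily S₁ S₂ S₃ i ∈ 𝔤.toSubmodule := fun i => by
    rw [h𝔤]; exact Submodule.subset_span ⟨i, rfl⟩
  have hC𝔤 : C ≤ 𝔤.toSubmodule := by
    rw [hC, Submodule.span_le]
    rintro x (rfl | rfl)
    exacts [hmem 6, hmem 7]
  have habel : ∀ x ∈ C, ∀ y ∈ C, ⁅x, y⁆ = 0 := by
    intro x hx y hy
    obtain ⟨a, b, rfl⟩ := Submodule.mem_span_pair.1 hx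
    obtain ⟨a', b', rfl⟩ := Submodule.mem_span_pair.1 hy
    have h' : ⁅cartanTwo S₁ S₂ S₃, cartanOne S₁ S₂ S₃⁆ = 0 := by
      rw [← lie_skew, r.lie_cartan, neg_zero]
    simp [r.lie_cartan, h']
  let 𝔥 : LieSubalgebra ℝ 𝔤 :=
    { C.comap 𝔤.toSubmodule.subtype with
      lie_mem' := fun {x y} hx hy => by
        have h : ((⁅x, y⁆ : 𝔤) : L) = 0 := habel _ hx _ hy
        change ((⁅x, y⁆ : 𝔤) : L) ∈ C
        rw [h]
        exact C.zero_mem }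
  have mem𝔥 (x : 𝔤) : x ∈ 𝔥 ↔ (x : L) ∈ C := Iff.rfl
  refine ⟨𝔥, ⟨?_, ?_⟩, ?_⟩
  · have : IsLieAbelian 𝔥 := ⟨fun x y => Subtype.ext (Subtype.ext (habel _ x.2 _ y.2))⟩
    infer_instance
  · refine le_antisymm (fun x hx => ?_) 𝔥.le_normalizer
    rw [LieSubalgebra.mem_normalizer_iff'] at hx
    have hx𝔤 : (x : L) ∈ Submodule.span ℝ (Set.range (bracketFamily S₁ S₂ S₃)) := by
      rw [← h𝔤]
      exact x.2
    obtain ⟨c, hc⟩ := (Submodule.mem_span_range_iff_exists_fun ℝ).1 hx𝔤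
    have h₁ : ⁅cartanOne S₁ S₂ S₃, (x : L)⁆ ∈ C :=
      hx ⟨_, hmem 6⟩ (Submodule.subset_span (by simp [cartanOne_eq_family]))
    have h₂ : ⁅cartanTwo S₁ S₂ S₃, (x : L)⁆ ∈ C :=
      hx ⟨_, hmem 7⟩ (Submodule.subset_span (by simp [cartanTwo_eq_family]))
    rw [← hc] at h₁ h₂
    have hz (i : Fin 14) (h₆ : i ≠ 6) (h₇ : i ≠ 7) : c i = 0 := by
      have k₁ := coeff_eq_zero_of_lie_mem hli h₁ r.root_one i h₆ h₇
      have k₂ := coeff_eq_zero_of_lie_mem hli h₂ r.root_two i h₆ h₇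
      have k : (rootDiagram i).1 ≠ 0 ∨ (rootDiagram i).2 ≠ 0 := by
        fin_cases i <;> simp [rootDiagram] at h₆ h₇ ⊢
      rcases k with k | k
      · exact (mul_eq_zero.1 k₁).resolve_right k
      · exact (mul_eq_zero.1 k₂).resolve_right k
    rw [mem𝔥, ← hc]
    refine Submodule.sum_mem _ fun i _ => ?_
    by_cases h₆ : i = 6
    · subst h₆
      exact C.smul_mem _ (Submodule.subset_span (by simp [cartanOne_eq_family]))
    by_cases h₇ : i = 7
    · subst h₇
      exact C.smul_mem _ (Submodule.subset_span (by simp [cartanTwo_eq_family]))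
    rw [hz i h₆ h₇, zero_smul]
    exact C.zero_mem
  · exact (Submodule.map_comap_subtype _ _).trans (inf_eq_right.2 hC𝔤)

end ShortRootRelations

end ShortRoots

/-! ### Polynomial vector fields -/

namespace Flat

open MvPolynomial

/-- Polynomial vector fields on the five-dimensional affine space. -/
abbrev PolyField : Type := Derivation ℝ (MvPolynomial (Fin 5) ℝ) (MvPolynomial (Fin 5) ℝ)

theorem derivation_ofNat (D : PolyField) (n : ℕ) [n.AtLeastTwo] :
    D (ofNat(n) : MvPolynomial (Fin 5) ℝ) = 0 :=
  D.map_natCast n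

theorem C_ofNat (n : ℕ) [n.AtLeastTwo] :
    (C (ofNat(n) : ℝ) : MvPolynomial (Fin 5) ℝ) = ofNat(n) :=
  map_ofNat C n

/-- The polynomial vector field `S₁`. -/
def S₁ : PolyField :=
  mkDerivation ℝ ![1,
    0,
    -2*X 1,
    -3*X 2,
    X 1^2]

/-- The polynomial vector field `S₂`. -/
def S₂ : PolyField :=
  mkDerivation ℝ ![0,
    1,
    0,
    0,
    0]

/-- The polynomial vector field `S₃`. -/
def S₃ : PolyField :=
  mkDerivation ℝ ![-2*X 0^2*X 1 -X 0*X 2 + X 3,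
    -3*X 0*X 1^2 -4*X 1*X 2 -3*X 4,
    3*X 0^2*X 1^2 -2*X 1*X 3 -X 2^2,
    -3*X 0^3*X 1^2 -3*X 2*X 3,
    3*X 0*X 1^2*X 2 + X 1^2*X 3 + 2*X 1*X 2^2]

/-- The polynomial vector field `S₄`. -/
def S₄ : PolyField :=
  mkDerivation ℝ ![0,
    0,
    2,
    0,
    -2*X 1]

/-- The polynomial vector field `S₅`. -/
def S₅ : PolyField :=
  mkDerivation ℝ ![-2*X 0^2,
    -6*X 0*X 1 -4*X 2,
    6*X 0^2*X 1 -2*X 3,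
    -6*X 0^3*X 1,
    6*X 0*X 1*X 2 + 2*X 1*X 3 + 2*X 2^2]

/-- The polynomial vector field `S₆`. -/
def S₆ : PolyField :=
  mkDerivation ℝ ![2*X 0*X 1 + 4*X 2,
    -2*X 1^2,
    -2*X 1*X 2 + 6*X 4,
    -6*X 2^2,
    -6*X 1*X 4]

/-- The polynomial vector field `h`. -/
def h : PolyField :=
  mkDerivation ℝ ![-2*X 0,
    -2*X 1,
    -4*X 2,
    -6*X 3,
    -6*X 4]

/-- The polynomial vector field `H`. -/
def H : PolyField :=
  mkDerivation ℝ ![2*X 0,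
    -4*X 1,
    -2*X 2,
    0,
    -6*X 4]

/-- The polynomial vector field `L₁`. -/
def L₁ : PolyField :=
  mkDerivation ℝ ![0,
    0,
    0,
    6,
    0]

/-- The polynomial vector field `L₂`. -/
def L₂ : PolyField :=
  mkDerivation ℝ ![0,
    0,
    0,
    0,
    -2]

/-- The polynomial vector field `L₃`. -/
def L₃ : PolyField :=
  mkDerivation ℝ ![0,
    -6*X 0,
    6*X 0^2,
    -6*X 0^3,
    6*X 0*X 2 + 2*X 3]

/-- The polynomial vector field `L₄`. -/
def L₄ : PolyField :=
  mkDerivation ℝ ![-6*X 0^2*X 2 -6*X 0*X 3,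
    18*X 0*X 4 -6*X 2^2,
    -18*X 0^2*X 4 -6*X 2*X 3,
    18*X 0^3*X 4 -6*X 3^2,
    -18*X 0*X 2*X 4 + 4*X 2^3 -6*X 3*X 4]

/-- The polynomial vector field `L₅`. -/
def L₅ : PolyField :=
  mkDerivation ℝ ![6*X 0^2*X 1^2 + 6*X 0*X 1*X 2 -6*X 1*X 3 + 6*X 2^2,
    6*X 0*X 1^3 + 12*X 1^2*X 2 + 18*X 1*X 4,
    -6*X 0^2*X 1^3 + 6*X 1^2*X 3 + 6*X 1*X 2^2 + 18*X 2*X 4,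
    6*X 0^3*X 1^3 + 18*X 1*X 2*X 3 -6*X 2^3 + 18*X 3*X 4,
    -6*X 0*X 1^3*X 2 -2*X 1^3*X 3 -6*X 1^2*X 2^2 + 18*X 4^2]

/-- The polynomial vector field `L₆`. -/
def L₆ : PolyField :=
  mkDerivation ℝ ![-6*X 1,
    0,
    6*X 1^2,
    18*X 1*X 2 + 18*X 4,
    -2*X 1^3]

theorem lie_S₁_S₂ : ⁅S₁, S₂⁆ = S₄ := by
  ext i : 1
  rw [Derivation.commutator_apply]
  fin_cases i <;>
  · simp [S₁, S₂, S₄, mkDerivation_X, Derivation.leibniz, Derivation.leibniz_pow,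
      smul_eq_C_mul, derivation_ofNat, C_ofNat]
    try ring

theorem lie_S₂_S₃ : ⁅S₂, S₃⁆ = S₅ := by
  ext i : 1
  rw [Derivation.commutator_apply]
  fin_cases i <;>
  · simp [S₂, S₃, S₅, mkDerivation_X, Derivation.leibniz, Derivation.leibniz_pow,
      smul_eq_C_mul, derivation_ofNat, C_ofNat]
    try ring

theorem lie_S₃_S₁ : ⁅S₃, S₁⁆ = S₆ := by
  ext i : 1
  rw [Derivation.commutator_apply]
  fin_cases i <;>
  · simp [S₃, S₁, S₆, mkDerivation_X, Derivation.leibniz, Derivation.leibniz_pow,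
      smul_eq_C_mul, derivation_ofNat, C_ofNat]
    try ring

theorem lie_S₄_S₃ : ⁅S₄, S₃⁆ = h := by
  ext i : 1
  rw [Derivation.commutator_apply]
  fin_cases i <;>
  · simp [S₄, S₃, h, mkDerivation_X, Derivation.leibniz, Derivation.leibniz_pow,
      smul_eq_C_mul, derivation_ofNat, C_ofNat]
    try ring

theorem lie_S₂_S₆ : ⁅S₂, S₆⁆ = H := by
  ext i : 1
  rw [Derivation.commutator_apply]
  fin_cases i <;>
  · simp [S₂, S₆, H, mkDerivation_X, Derivation.leibniz, Derivation.leibniz_pow,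
      smul_eq_C_mul, derivation_ofNat, C_ofNat]
    try ring

theorem lie_S₁_S₄ : ⁅S₁, S₄⁆ = L₁ := by
  ext i : 1
  rw [Derivation.commutator_apply]
  fin_cases i <;>
  · simp [S₁, S₄, L₁, mkDerivation_X, Derivation.leibniz, Derivation.leibniz_pow,
      smul_eq_C_mul, derivation_ofNat, C_ofNat]
    try ring

theorem lie_S₂_S₄ : ⁅S₂, S₄⁆ = L₂ := by
  ext i : 1
  rw [Derivation.commutator_apply]
  fin_cases i <;>
  · simp [S₂, S₄, L₂, mkDerivation_X, Derivation.leibniz, Derivation.leibniz_pow,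
      smul_eq_C_mul, derivation_ofNat, C_ofNat]
    try ring

theorem lie_S₂_S₅ : ⁅S₂, S₅⁆ = L₃ := by
  ext i : 1
  rw [Derivation.commutator_apply]
  fin_cases i <;>
  · simp [S₂, S₅, L₃, mkDerivation_X, Derivation.leibniz, Derivation.leibniz_pow,
      smul_eq_C_mul, derivation_ofNat, C_ofNat]
    try ring

theorem lie_S₃_S₅ : ⁅S₃, S₅⁆ = L₄ := by
  ext i : 1
  rw [Derivation.commutator_apply]
  fin_cases i <;>
  · simp [S₃, S₅, L₄, mkDerivation_X, Derivation.leibniz, Derivation.leibniz_pow,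
      smul_eq_C_mul, derivation_ofNat, C_ofNat]
    try ring

theorem lie_S₃_S₆ : ⁅S₃, S₆⁆ = L₅ := by
  ext i : 1
  rw [Derivation.commutator_apply]
  fin_cases i <;>
  · simp [S₃, S₆, L₅, mkDerivation_X, Derivation.leibniz, Derivation.leibniz_pow,
      smul_eq_C_mul, derivation_ofNat, C_ofNat]
    try ring

theorem lie_S₁_S₆ : ⁅S₁, S₆⁆ = L₆ := by
  ext i : 1
  rw [Derivation.commutator_apply]
  fin_cases i <;>
  · simp [S₁, S₆, L₆, mkDerivation_X, Derivation.leibniz, Derivation.leibniz_pow,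
      smul_eq_C_mul, derivation_ofNat, C_ofNat]
    try ring

theorem lie_h_S₁ : ⁅h, S₁⁆ = (2 : ℝ) • S₁ := by
  ext i : 1
  rw [Derivation.commutator_apply]
  fin_cases i <;>
  · simp [h, S₁, mkDerivation_X, Derivation.leibniz, Derivation.leibniz_pow,
      smul_eq_C_mul, derivation_ofNat, C_ofNat]
    try ring

theorem lie_h_S₂ : ⁅h, S₂⁆ = (2 : ℝ) • S₂ := by
  ext i : 1
  rw [Derivation.commutator_apply]
  fin_cases i <;>
  · simp [h, S₂, mkDerivation_X, Derivation.leibniz, Derivation.leibniz_pow,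
      smul_eq_C_mul, derivation_ofNat, C_ofNat]
    try ring

theorem lie_h_S₃ : ⁅h, S₃⁆ = (-4 : ℝ) • S₃ := by
  ext i : 1
  rw [Derivation.commutator_apply]
  fin_cases i <;>
  · simp [h, S₃, mkDerivation_X, Derivation.leibniz, Derivation.leibniz_pow,
      smul_eq_C_mul, derivation_ofNat, C_ofNat]
    try ring

theorem lie_H_S₁ : ⁅H, S₁⁆ = (-2 : ℝ) • S₁ := by
  ext i : 1
  rw [Derivation.commutator_apply]
  fin_cases i <;>
  · simp [H, S₁, mkDerivation_X, Derivation.leibniz, Derivation.leibniz_pow,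
      smul_eq_C_mul, derivation_ofNat, C_ofNat]
    try ring

theorem lie_H_S₂ : ⁅H, S₂⁆ = (4 : ℝ) • S₂ := by
  ext i : 1
  rw [Derivation.commutator_apply]
  fin_cases i <;>
  · simp [H, S₂, mkDerivation_X, Derivation.leibniz, Derivation.leibniz_pow,
      smul_eq_C_mul, derivation_ofNat, C_ofNat]
    try ring

theorem lie_H_S₃ : ⁅H, S₃⁆ = (-2 : ℝ) • S₃ := by
  ext i : 1
  rw [Derivation.commutator_apply]
  fin_cases i <;>
  · simp [H, S₃, mkDerivation_X, Derivation.leibniz, Derivation.leibniz_pow,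
      smul_eq_C_mul, derivation_ofNat, C_ofNat]
    try ring

theorem lie_S₁_L₁ : ⁅S₁, L₁⁆ = 0 := by
  ext i : 1
  rw [Derivation.commutator_apply]
  fin_cases i <;>
  · simp [S₁, L₁, mkDerivation_X, Derivation.leibniz, Derivation.leibniz_pow,
      smul_eq_C_mul, derivation_ofNat, C_ofNat]
    try ring

theorem lie_S₁_L₆ : ⁅S₁, L₆⁆ = 0 := by
  ext i : 1
  rw [Derivation.commutator_apply]
  fin_cases i <;>
  · simp [S₁, L₆, mkDerivation_X, Derivation.leibniz, Derivation.leibniz_pow,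
      smul_eq_C_mul, derivation_ofNat, C_ofNat]
    try ring

theorem lie_S₁_L₃ : ⁅S₁, L₃⁆ = (-6 : ℝ) • S₂ := by
  ext i : 1
  rw [Derivation.commutator_apply]
  fin_cases i <;>
  · simp [S₁, L₃, S₂, mkDerivation_X, Derivation.leibniz, Derivation.leibniz_pow,
      smul_eq_C_mul, derivation_ofNat, C_ofNat]
    try ring

theorem lie_S₂_L₃ : ⁅S₂, L₃⁆ = 0 := by
  ext i : 1
  rw [Derivation.commutator_apply]
  fin_cases i <;>
  · simp [S₂, L₃, mkDerivation_X, Derivation.leibniz, Derivation.leibniz_pow,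
      smul_eq_C_mul, derivation_ofNat, C_ofNat]
    try ring

theorem lie_S₅_L₃ : ⁅S₅, L₃⁆ = 0 := by
  ext i : 1
  rw [Derivation.commutator_apply]
  fin_cases i <;>
  · simp [S₅, L₃, mkDerivation_X, Derivation.leibniz, Derivation.leibniz_pow,
      smul_eq_C_mul, derivation_ofNat, C_ofNat]
    try ring

theorem lie_S₅_L₄ : ⁅S₅, L₄⁆ = 0 := by
  ext i : 1
  rw [Derivation.commutator_apply]
  fin_cases i <;>
  · simp [S₅, L₄, mkDerivation_X, Derivation.leibniz, Derivation.leibniz_pow,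
      smul_eq_C_mul, derivation_ofNat, C_ofNat]
    try ring

theorem lie_S₅_L₆ : ⁅S₅, L₆⁆ = (6 : ℝ) • S₆ := by
  ext i : 1
  rw [Derivation.commutator_apply]
  fin_cases i <;>
  · simp [S₅, L₆, S₆, mkDerivation_X, Derivation.leibniz, Derivation.leibniz_pow,
      smul_eq_C_mul, derivation_ofNat, C_ofNat]
    try ring

theorem lie_S₅_S₆ : ⁅S₅, S₆⁆ = (-8 : ℝ) • S₃ := by
  ext i : 1
  rw [Derivation.commutator_apply]
  fin_cases i <;>
  · simp [S₅, S₆, S₃, mkDerivation_X, Derivation.leibniz, Derivation.leibniz_pow,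
      smul_eq_C_mul, derivation_ofNat, C_ofNat]
    try ring

theorem lie_S₆_L₆ : ⁅S₆, L₆⁆ = 0 := by
  ext i : 1
  rw [Derivation.commutator_apply]
  fin_cases i <;>
  · simp [S₆, L₆, mkDerivation_X, Derivation.leibniz, Derivation.leibniz_pow,
      smul_eq_C_mul, derivation_ofNat, C_ofNat]
    try ring

theorem lie_L₃_L₆ : ⁅L₃, L₆⁆ = (-6 : ℝ) • h + (12 : ℝ) • H := by
  ext i : 1
  rw [Derivation.commutator_apply]
  fin_cases i <;>
  · simp [L₃, L₆, h, H, mkDerivation_X, Derivation.leibniz, Derivation.leibniz_pow,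
      smul_eq_C_mul, derivation_ofNat, C_ofNat]
    try ring

theorem shortRootRelations : ShortRootRelations S₁ S₂ S₃ where
  h_S₁ := by rw [lie_S₁_S₂, lie_S₄_S₃, lie_h_S₁]
  h_S₂ := by rw [lie_S₁_S₂, lie_S₄_S₃, lie_h_S₂]
  h_S₃ := by rw [lie_S₁_S₂, lie_S₄_S₃, lie_h_S₃]
  H_S₁ := by rw [lie_S₃_S₁, lie_S₂_S₆, lie_H_S₁]
  H_S₂ := by rw [lie_S₃_S₁, lie_S₂_S₆, lie_H_S₂]
  H_S₃ := by rw [lie_S₃_S₁, lie_S₂_S₆, lie_H_S₃]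
  S₁_L₁ := by rw [lie_S₁_S₂, lie_S₁_S₄, lie_S₁_L₁]
  S₁_L₆ := by rw [lie_S₃_S₁, lie_S₁_S₆, lie_S₁_L₆]
  S₁_L₃ := by rw [lie_S₂_S₃, lie_S₂_S₅, lie_S₁_L₃]
  S₂_L₃ := by rw [lie_S₂_S₃, lie_S₂_S₅, lie_S₂_L₃]
  S₅_L₃ := by rw [lie_S₂_S₃, lie_S₂_S₅, lie_S₅_L₃]
  S₅_L₄ := by rw [lie_S₂_S₃, lie_S₃_S₅, lie_S₅_L₄]
  S₅_L₆ := by rw [lie_S₂_S₃, lie_S₃_S₁, lie_S₁_S₆, lie_S₅_L₆]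
  S₅_S₆ := by rw [lie_S₂_S₃, lie_S₃_S₁, lie_S₅_S₆]
  S₆_L₆ := by rw [lie_S₃_S₁, lie_S₁_S₆, lie_S₆_L₆]
  L₃_L₆ := by
    rw [lie_S₂_S₃, lie_S₂_S₅, lie_S₃_S₁, lie_S₁_S₆, lie_S₁_S₂, lie_S₄_S₃, lie_S₂_S₆, lie_L₃_L₆]

theorem bracketFamily_eq : bracketFamily S₁ S₂ S₃ =
    ![S₁, S₂, S₃, S₄, S₅, S₆, (1 / 4 : ℝ) • (h - H), (√3 / 12 : ℝ) • (h + H),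
      L₁, L₂, L₃, L₄, L₅, L₆] := by
  simp only [bracketFamily, cartanOne, cartanTwo, lie_S₁_S₂, lie_S₂_S₃, lie_S₃_S₁, lie_S₄_S₃,
    lie_S₂_S₆, lie_S₁_S₄, lie_S₂_S₄, lie_S₂_S₅, lie_S₃_S₅, lie_S₃_S₆, lie_S₁_S₆]

end Flat

namespace Flat

open MvPolynomial

variable {𝕜 : Type*} [RCLike 𝕜]

/-- The vector field on `𝕜⁵` defined by a polynomial vector field. -/
def evalField (D : PolyField) (y : Coord 𝕜) : Coord 𝕜 := fun i => aeval y (D (X i))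

theorem contDiff_aeval (p : MvPolynomial (Fin 5) ℝ) :
    ContDiff 𝕜 ∞ (fun y : Coord 𝕜 => aeval y p) := by
  induction p using MvPolynomial.induction_on with
  | C a => simpa using contDiff_const
  | add p q hp hq => simpa using hp.add hq
  | mul_X p i hp => simpa using hp.mul (contDiff_apply 𝕜 𝕜 i)

theorem contDiff_evalField (D : PolyField) : ContDiff 𝕜 ∞ (evalField (𝕜 := 𝕜) D) :=
  contDiff_pi.2 fun i => contDiff_aeval (D (X i))

theorem differentiableAt_evalField (D : PolyField) (y : Coord 𝕜) :
    DifferentiableAt 𝕜 (evalField (𝕜 := 𝕜) D) y :=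
  (contDiff_evalField D).contDiffAt.differentiableAt (by simp)

theorem fderiv_aeval (D : PolyField) (p : MvPolynomial (Fin 5) ℝ) (y : Coord 𝕜) :
    fderiv 𝕜 (fun y : Coord 𝕜 => aeval y p) y (evalField D y) = aeval y (D p) := by
  have hd (q : MvPolynomial (Fin 5) ℝ) :
      DifferentiableAt 𝕜 (fun y : Coord 𝕜 => aeval y q) y :=
    (contDiff_aeval q).contDiffAt.differentiableAt (by simp)
  induction p using MvPolynomial.induction_on with
  | C a => simp
  | add p q hp hq =>
    simp only [map_add]
    rw [fderiv_fun_add (hd p) (hd q), add_apply, hp, hq]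
  | mul_X p i hp =>
    have hX : fderiv 𝕜 (fun y : Coord 𝕜 => y i) y = ContinuousLinearMap.proj i :=
      (ContinuousLinearMap.proj (R := 𝕜) (φ := fun _ : Fin 5 => 𝕜) i).fderiv
    simp only [map_mul, aeval_X, Derivation.leibniz, smul_eq_mul, map_add]
    rw [fderiv_fun_mul (hd p) (by fun_prop), add_apply,
      smul_apply, smul_apply, hp, hX]
    simp [evalField]

theorem evalField_lie (D E : PolyField) (y : Coord 𝕜) :
    evalField ⁅D, E⁆ y = VectorField.lieBracket 𝕜 (evalField D) (evalField E) y := by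
  have h (D E : PolyField) (i : Fin 5) :
      fderiv 𝕜 (evalField (𝕜 := 𝕜) E) y (evalField D y) i = aeval y (D (E (X i))) := by
    rw [← fderiv_aeval]
    have h' := fderiv_pi (𝕜 := 𝕜) (φ := fun i (y : Coord 𝕜) => aeval y (E (X i))) (x := y)
      fun i => (contDiff_aeval (E (X i))).contDiffAt.differentiableAt (by simp)
    change fderiv 𝕜 (fun y i => aeval y (E (X i))) y (evalField D y) i = _
    rw [h']
    rfl
  funext i
  rw [VectorField.lieBracket_eq]
  simp only [Pi.sub_apply]
  rw [h, h, ← map_sub, ← Derivation.commutator_apply]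
  rfl

section Pullback

variable {Ω : TopologicalSpace.Opens (Coord 𝕜)} {φ : Coord 𝕜 → Coord 𝕜}

theorem contDiffOn_pullback (hφ : ContDiffOn 𝕜 ∞ φ Ω)
    (hinv : ∀ x ∈ Ω, (fderiv 𝕜 φ x).IsInvertible) (D : PolyField) :
    ContDiffOn 𝕜 ∞ (VectorField.pullback 𝕜 φ (evalField D)) Ω := by
  intro x hx
  have hx' : ContDiffAt 𝕜 ∞ φ x := hφ.contDiffAt (Ω.isOpen.mem_nhds hx)
  obtain ⟨e, he⟩ := hinv x hx
  have h₁ : ContDiffAt 𝕜 ∞ (fderiv 𝕜 φ) x := hx'.fderiv_right (by simp)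
  have h₂ : ContDiffAt 𝕜 ∞ (fun u => (fderiv 𝕜 φ u).inverse) x :=
    (he ▸ contDiffAt_map_inverse e : ContDiffAt 𝕜 ∞ ContinuousLinearMap.inverse _).comp x h₁
  have h₃ : ContDiffAt 𝕜 ∞ (fun u => evalField D (φ u)) x :=
    (contDiff_evalField D).contDiffAt.comp x hx'
  exact (h₂.clm_apply h₃).contDiffWithinAt

/-- Pulling back polynomial vector fields along a local diffeomorphism. -/
def pullbackHom (hφ : ContDiffOn 𝕜 ∞ φ Ω) (hinv : ∀ x ∈ Ω, (fderiv 𝕜 φ x).IsInvertible) :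
    PolyField →ₗ⁅ℝ⁆ SmoothFields 𝕜 Ω where
  toFun D := SmoothFields.mk _ (contDiffOn_pullback hφ hinv D)
  map_add' D E := SmoothFields.ext_on fun x hx => by
    change _ = (SmoothFields.mk _ _).1 x + (SmoothFields.mk _ _).1 x
    simp only [SmoothFields.mk_apply _ _ hx, VectorField.pullback]
    rw [← map_add]
    congr 1
    funext i
    simp [evalField]
  map_smul' t D := SmoothFields.ext_on fun x hx => by
    change _ = t • (SmoothFields.mk _ (contDiffOn_pullback hφ hinv D)).1 x
    simp only [SmoothFields.mk_apply _ _ hx, VectorField.pullback]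
    have h : evalField (t • D) (φ x) = (t : 𝕜) • evalField D (φ x) := by
      funext i
      simp [evalField, RCLike.real_smul_eq_coe_mul]
    rw [h, map_smul]
    funext i
    simp [RCLike.real_smul_eq_coe_mul]
  map_lie' {D E} := SmoothFields.ext_on fun x hx => by
    have hmk (D : PolyField) :
        (SmoothFields.mk _ (contDiffOn_pullback hφ hinv D)).1 =ᶠ[𝓝 x]
          VectorField.pullback 𝕜 φ (evalField D) := by
      filter_upwards [Ω.isOpen.mem_nhds hx] with u hu
      exact SmoothFields.mk_apply _ _ hu
    change (SmoothFields.mk _ (contDiffOn_pullback hφ hinv ⁅D, E⁆)).1 x = _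
    rw [SmoothFields.bracket_apply _ _ hx, (hmk D).lieBracket_vectorField_eq (hmk E),
      ← VectorField.pullback_lieBracket (n := ∞) _ (hφ.contDiffAt (Ω.isOpen.mem_nhds hx))
        (differentiableAt_evalField D _) (differentiableAt_evalField E _),
      SmoothFields.mk_apply _ _ hx]
    · simp only [VectorField.pullback]
      rw [evalField_lie]
    · rw [minSmoothness_of_isRCLikeNormedField]
      exact WithTop.coe_le_coe.2 le_top

theorem pullbackHom_apply (hφ : ContDiffOn 𝕜 ∞ φ Ω)
    (hinv : ∀ x ∈ Ω, (fderiv 𝕜 φ x).IsInvertible) (D : PolyField) {x : Coord 𝕜} (hx : x ∈ Ω) :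
    (pullbackHom hφ hinv D).1 x = (fderiv 𝕜 φ x).inverse (evalField D (φ x)) :=
  SmoothFields.mk_apply _ (contDiffOn_pullback hφ hinv D) hx

theorem fderiv_pullbackHom (hφ : ContDiffOn 𝕜 ∞ φ Ω)
    (hinv : ∀ x ∈ Ω, (fderiv 𝕜 φ x).IsInvertible) (D : PolyField) {x : Coord 𝕜} (hx : x ∈ Ω) :
    fderiv 𝕜 φ x ((pullbackHom hφ hinv D).1 x) = evalField D (φ x) := by
  rw [pullbackHom_apply _ _ _ hx]
  exact VectorField.fderiv_pullback φ (evalField D) x (hinv x hx)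

theorem pullbackHom_apply_eq (hφ : ContDiffOn 𝕜 ∞ φ Ω)
    (hinv : ∀ x ∈ Ω, (fderiv 𝕜 φ x).IsInvertible) (D : PolyField) {x v : Coord 𝕜} (hx : x ∈ Ω)
    (hv : fderiv 𝕜 φ x v = evalField D (φ x)) : (pullbackHom hφ hinv D).1 x = v := by
  rw [pullbackHom_apply _ _ _ hx, ← hv]
  obtain ⟨e, he⟩ := hinv x hx
  rw [← he]
  simp

/-- Polynomial vector fields that satisfy a linear relation on the image of a local
diffeomorphism satisfy it everywhere. -/
theorem sum_aeval_eq_zero {ι : Type*} [Fintype ι] (hφ : ContDiffOn 𝕜 ∞ φ Ω)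
    (hinv : ∀ x ∈ Ω, (fderiv 𝕜 φ x).IsInvertible) (hne : (Ω : Set (Coord 𝕜)).Nonempty)
    (D : ι → PolyField) (c : ι → 𝕜) (h : ∑ i, c i • (pullbackHom hφ hinv (D i)).1 = 0)
    (y : Coord 𝕜) (j : Fin 5) : ∑ i, c i * aeval y (D i (X j)) = 0 := by
  obtain ⟨x₀, hx₀⟩ := hne
  obtain ⟨e, he⟩ := hinv x₀ hx₀
  have hx₀' : ContDiffAt 𝕜 ∞ φ x₀ := hφ.contDiffAt (Ω.isOpen.mem_nhds hx₀)
  have hstrict : HasStrictFDerivAt φ (e : Coord 𝕜 →L[𝕜] Coord 𝕜) x₀ := by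
    rw [he]
    exact hx₀'.hasStrictFDerivAt (by simp)
  have himg : φ '' Ω ∈ 𝓝 (φ x₀) := by
    rw [← hstrict.map_nhds_eq_of_equiv]
    exact Filter.image_mem_map (Ω.isOpen.mem_nhds hx₀)
  let p : MvPolynomial (Fin 5) 𝕜 := ∑ i, C (c i) * map (algebraMap ℝ 𝕜) (D i (X j))
  have hp (y : Coord 𝕜) : eval y p = ∑ i, c i * aeval y (D i (X j)) := by
    simp [p, eval_map, aeval_def]
  have hzero : ∀ y ∈ φ '' Ω, eval y p = 0 := by
    rintro _ ⟨x, hx, rfl⟩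
    have hx' := congrArg (fderiv 𝕜 φ x) (congrFun h x)
    rw [Finset.sum_apply, map_sum] at hx'
    simp only [Pi.smul_apply, map_smul, fderiv_pullbackHom hφ hinv _ hx, Pi.zero_apply,
      map_zero] at hx'
    have hj := congrFun hx' j
    rw [hp]
    simpa [evalField] using hj
  obtain ⟨ε, hε, hball⟩ := Metric.mem_nhds_iff.1 himg
  have hp0 : p = 0 := by
    refine MvPolynomial.funext_set (fun i => Metric.ball (φ x₀ i) ε) (fun i => ?_) fun y hy => ?_
    · exact infinite_of_mem_nhds (φ x₀ i) (Metric.ball_mem_nhds _ hε)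
    · rw [map_zero]
      refine hzero y (hball ?_)
      rw [ball_pi _ hε]
      exact hy
  rw [← hp, hp0, map_zero]

end Pullback

/-- The fourteen polynomial vector fields are linearly independent over `𝕜`. -/
theorem coeff_eq_zero (c : Fin 14 → 𝕜)
    (h : ∀ (y : Coord 𝕜) (j : Fin 5), ∑ i, c i * aeval y (bracketFamily S₁ S₂ S₃ i (X j)) = 0) :
    ∀ i, c i = 0 := by
  simp only [bracketFamily_eq, Fin.sum_univ_succ, Fin.succ_zero_eq_one, Fin.succ_one_eq_two,
    Finset.univ_eq_empty, Finset.sum_empty, Matrix.cons_val] at h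
  have e0 (y : Coord 𝕜) := h y 0
  have e1 (y : Coord 𝕜) := h y 1
  have c3 := h 0 2
  have c8 := h 0 3
  have c9 := h 0 4
  clear h
  have a4 := map_ofNat (algebraMap ℝ 𝕜) 4
  have a12 := map_ofNat (algebraMap ℝ 𝕜) 12
  have k2 : constantCoeff (2 : MvPolynomial (Fin 5) ℝ) = 2 := map_ofNat constantCoeff 2
  have hs : algebraMap ℝ 𝕜 √3 ≠ 0 := by simp
  simp [S₁, S₂, S₃, S₄, S₅, S₆, Flat.h, H, L₁, L₂, L₃, L₄, L₅, L₆, mkDerivation_X,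
    Algebra.smul_def, a4, a12, k2] at e0 e1 c3 c8 c9
  generalize algebraMap ℝ 𝕜 √3 = s at hs e1
  have c0 : c 0 = 0 := by simpa using e0 0
  have c1 : c 1 = 0 := by simpa using e1 0
  have c2 : c 2 = 0 := by simpa [c0] using e0 ![0, 0, 0, 1, 0]
  have c5 : c 5 = 0 := by
    have u₁ := e0 ![0, 0, 1, 0, 0]
    have u₂ := e0 ![0, 0, -1, 0, 0]
    simp [c0, c2] at u₁ u₂
    linear_combination (1 / 8) * u₁ - (1 / 8) * u₂
  have c13 : c 13 = 0 := by simpa [c0, c2] using e0 ![0, 1, 0, 0, 0]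
  have u₁ := e0 ![1, 0, 0, 0, 0]
  have u₂ := e0 ![-1, 0, 0, 0, 0]
  simp [c0, c2, c5, c13] at u₁ u₂
  have c4 : c 4 = 0 := by linear_combination (-1 / 4) * u₁ + (-1 / 4) * u₂
  have c6 : c 6 = 0 := by linear_combination (-1 / 2) * u₁ + (1 / 2) * u₂
  have c10 : c 10 = 0 := by simpa [c1, c2, c4, c5, c6] using e1 ![1, 0, 0, 0, 0]
  have c7 : c 7 = 0 := by
    have u := e1 ![0, 1, 0, 0, 0]
    simp [c1, c2, c4, c5, c6, c10] at u
    refine u.resolve_right fun u => hs ?_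
    linear_combination -2 * u
  have c11 : c 11 = 0 := by simpa [c1, c2, c4, c5, c6, c7, c10] using e1 ![0, 0, 1, 0, 0]
  have c12 : c 12 = 0 := by
    simpa [c1, c2, c4, c5, c6, c7, c10, c11] using e1 ![1, 1, 0, 0, 0]
  intro i
  fin_cases i <;> assumption

end Flat

theorem isMaximallySymmetric_of_fderiv_image {𝕜 : Type*} [RCLike 𝕜]
    {Ω : TopologicalSpace.Opens (Coord 𝕜)} {φ : Coord 𝕜 → Coord 𝕜}
    {D : Coord 𝕜 → Submodule 𝕜 (Coord 𝕜)} (hφ : ContDiffOn 𝕜 ∞ φ Ω)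
    (hinv : ∀ x ∈ Ω, (fderiv 𝕜 φ x).IsInvertible)
    (hD : ∀ x ∈ Ω, fderiv 𝕜 φ x '' (D x : Set (Coord 𝕜)) = flatCartan (φ x)) :
    IsMaximallySymmetric D Ω := by
  intro x hx
  have hφ' (u : Coord 𝕜) (hu : u ∈ Ω) : ContDiffAt 𝕜 ∞ φ u :=
    hφ.contDiffAt (Ω.isOpen.mem_nhds hu)
  have hd (u : Coord 𝕜) (hu : u ∈ Ω) : HasFDerivAt φ (fderiv 𝕜 φ u) u :=
    ((hφ' u hu).differentiableAt (by simp)).hasFDerivAt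
  obtain ⟨f', hf'⟩ := hinv x hx
  let e := ((hφ' x hx).toOpenPartialHomeomorph φ (f' := f') (hf' ▸ hd x hx)
    (by simp)).restrOpen Ω Ω.isOpen
  have hsrc : e.source ⊆ Ω := by
    intro u hu
    exact ((OpenPartialHomeomorph.restrOpen_source _ _ _).subset hu).2
  have he : (e : Coord 𝕜 → Coord 𝕜) = φ := rfl
  refine ⟨e, ?_, hsrc, ?_, ?_, fun u hu => ?_⟩
  · rw [OpenPartialHomeomorph.restrOpen_source]
    exact ⟨(hφ' x hx).mem_toOpenPartialHomeomorph_source (hf' ▸ hd x hx) (by simp), hx⟩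
  · exact hφ.mono hsrc
  · intro a ha
    have hu : e.symm a ∈ Ω := hsrc (e.map_target ha)
    obtain ⟨g', hg'⟩ := hinv _ hu
    refine (e.contDiffAt_symm (f₀' := g') ha ?_ ?_).contDiffWithinAt
    · rw [hg', he]
      exact hd _ hu
    · exact hφ' _ hu
  · rw [he]
    exact hD u (hsrc hu)

/-! ### Flat coordinates -/

namespace Chart

variable {𝕜 : Type*} [RCLike 𝕜]

theorem sqrtTwo_sq : sqrtTwo 𝕜 ^ 2 = 2 := by
  rw [sqrtTwo, ← RCLike.ofReal_pow, Real.sq_sqrt (by norm_num), RCLike.ofReal_ofNat]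

theorem sqrtTwo_ne_zero : sqrtTwo 𝕜 ≠ 0 := fun h => by
  have h' := sqrtTwo_sq (𝕜 := 𝕜)
  rw [h] at h'
  norm_num at h'

/-! The coefficients of the flat coordinates as functions of `r`. -/

variable (α β κ : 𝕜)

def N (r : 𝕜) : 𝕜 := 3 * α * r ^ 2 + β * (2 * r ^ 3 - 1)
def A (r : 𝕜) : 𝕜 := 48 / κ ^ 3 * r
def B (r : 𝕜) : 𝕜 := 8 / κ * (N α β r / (r ^ 3 + 1))
def C (r : 𝕜) : 𝕜 := 2 * κ * (lameY α β r ^ 2 / (r ^ 3 + 1) ^ 3)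
def D (r : 𝕜) : 𝕜 := 6 / κ ^ 3 * r ^ 2
def E (r : 𝕜) : 𝕜 := 1 / κ * (lameY α β r / (r ^ 3 + 1))
def F (r : 𝕜) : 𝕜 := 3 / (4 * κ ^ 3) * (r ^ 3 + 1)
def a (r : 𝕜) : 𝕜 := -96 / κ ^ 6 * (2 * r ^ 3 - 1)
def b (r : 𝕜) : 𝕜 := -96 / κ ^ 4 * (r * lameY α β r / (r ^ 3 + 1))
def c (r : 𝕜) : 𝕜 := -8 / κ ^ 2 * (N α β r * lameY α β r / (r ^ 3 + 1) ^ 2)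

/-- The flat coordinates. -/
def chart (x : Coord 𝕜) : Coord 𝕜 :=
  ![-(x 0) * 8⁻¹,
    sqrtTwo 𝕜 * (A κ (x 0) * x 1 + B α β κ (x 0) * x 3 + C α β κ (x 0) * x 4),
    sqrtTwo 𝕜 * (D κ (x 0) * x 1 + E α β κ (x 0) * x 3),
    sqrtTwo 𝕜 * (F κ (x 0) * x 1),
    -2 * x 2 + a κ (x 0) * x 1 ^ 2 + b α β κ (x 0) * x 1 * x 3 + c α β κ (x 0) * x 3 ^ 2]

/-! The derivatives of the coefficients. -/

def N' (r : 𝕜) : 𝕜 := 6 * α * r + 6 * β * r ^ 2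
def Y' (r : 𝕜) : 𝕜 := 6 * α * r ^ 2 + β * (4 * r ^ 3 - 2)
def B' (r : 𝕜) : 𝕜 :=
  8 / κ * ((N' α β r * (r ^ 3 + 1) - N α β r * (3 * r ^ 2)) / (r ^ 3 + 1) ^ 2)
def C' (r : 𝕜) : 𝕜 :=
  2 * κ * (lameY α β r * (2 * Y' α β r * (r ^ 3 + 1) - 9 * r ^ 2 * lameY α β r) / (r ^ 3 + 1) ^ 4)
def E' (r : 𝕜) : 𝕜 :=
  1 / κ * ((Y' α β r * (r ^ 3 + 1) - lameY α β r * (3 * r ^ 2)) / (r ^ 3 + 1) ^ 2)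
def b' (r : 𝕜) : 𝕜 :=
  -96 / κ ^ 4 * (((lameY α β r + r * Y' α β r) * (r ^ 3 + 1) - r * lameY α β r * (3 * r ^ 2)) /
    (r ^ 3 + 1) ^ 2)
def c' (r : 𝕜) : 𝕜 :=
  -8 / κ ^ 2 * (((N' α β r * lameY α β r + N α β r * Y' α β r) * (r ^ 3 + 1) -
    N α β r * lameY α β r * (6 * r ^ 2)) / (r ^ 3 + 1) ^ 3)

variable {α β κ}

section Derivatives

variable {r : 𝕜}

theorem hasDerivAt_R : HasDerivAt (fun r : 𝕜 => r ^ 3 + 1) (3 * r ^ 2) r :=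
  ((hasDerivAt_pow 3 r).add_const 1).congr_deriv (by push_cast; ring)

theorem hasDerivAt_Y : HasDerivAt (lameY α β) (Y' α β r) r :=
  (((((hasDerivAt_pow 3 r).const_mul 2).sub_const 1).const_mul α).fun_add
    (((hasDerivAt_id r).const_mul β).fun_mul ((hasDerivAt_pow 3 r).sub_const 2))).congr_deriv
    (by rw [Y']; push_cast; simp only [id]; ring)

theorem hasDerivAt_N : HasDerivAt (N α β) (N' α β r) r :=
  (((hasDerivAt_pow 2 r).const_mul (3 * α)).fun_add
    ((((hasDerivAt_pow 3 r).const_mul 2).sub_const 1).const_mul β)).congr_deriv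
    (by rw [N']; push_cast; ring)

theorem hasDerivAt_A : HasDerivAt (A κ) (48 / κ ^ 3) r :=
  ((hasDerivAt_id r).const_mul (48 / κ ^ 3)).congr_deriv (mul_one _)

theorem hasDerivAt_D : HasDerivAt (D κ) (6 / κ ^ 3 * (2 * r)) r :=
  ((hasDerivAt_pow 2 r).const_mul (6 / κ ^ 3)).congr_deriv (by push_cast; ring)

theorem hasDerivAt_F : HasDerivAt (F κ) (3 / (4 * κ ^ 3) * (3 * r ^ 2)) r :=
  hasDerivAt_R.const_mul (3 / (4 * κ ^ 3))

theorem hasDerivAt_a : HasDerivAt (a κ) (-96 / κ ^ 6 * (6 * r ^ 2)) r :=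
  ((((hasDerivAt_pow 3 r).const_mul 2).sub_const 1).const_mul (-96 / κ ^ 6)).congr_deriv
    (by push_cast; ring)

theorem hasDerivAt_B (hR : r ^ 3 + 1 ≠ 0) : HasDerivAt (B α β κ) (B' α β κ r) r :=
  ((hasDerivAt_N (α := α) (β := β) (r := r)).fun_div (hasDerivAt_R (r := r)) hR).const_mul (8 / κ)

theorem hasDerivAt_C (hR : r ^ 3 + 1 ≠ 0) : HasDerivAt (C α β κ) (C' α β κ r) r :=
  ((((hasDerivAt_Y (α := α) (β := β) (r := r)).fun_pow 2).fun_div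
    ((hasDerivAt_R (r := r)).fun_pow 3) (pow_ne_zero 3 hR)).const_mul (2 * κ)).congr_deriv (by
      rw [C']
      congr 1
      field_simp
      push_cast
      ring)

theorem hasDerivAt_E (hR : r ^ 3 + 1 ≠ 0) : HasDerivAt (E α β κ) (E' α β κ r) r :=
  ((hasDerivAt_Y (α := α) (β := β) (r := r)).fun_div (hasDerivAt_R (r := r)) hR).const_mul (1 / κ)

theorem hasDerivAt_b (hR : r ^ 3 + 1 ≠ 0) : HasDerivAt (b α β κ) (b' α β κ r) r :=
  ((((hasDerivAt_id r).fun_mul (hasDerivAt_Y (α := α) (β := β) (r := r))).fun_div (hasDerivAt_R (r := r))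
    hR).const_mul (-96 / κ ^ 4)).congr_deriv (by rw [b', one_mul]; rfl)

theorem hasDerivAt_c (hR : r ^ 3 + 1 ≠ 0) : HasDerivAt (c α β κ) (c' α β κ r) r :=
  ((((hasDerivAt_N (α := α) (β := β) (r := r)).fun_mul (hasDerivAt_Y (α := α) (β := β) (r := r))).fun_div
    ((hasDerivAt_R (r := r)).fun_pow 2)
    (pow_ne_zero 2 hR)).const_mul (-8 / κ ^ 2)).congr_deriv (by
      rw [c']
      congr 1
      field_simp
      push_cast
      ring)

end Derivatives

theorem hasFDerivAt_vec {f₀ f₁ f₂ f₃ f₄ : Coord 𝕜 → 𝕜} {L₀ L₁ L₂ L₃ L₄ : Coord 𝕜 →L[𝕜] 𝕜}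
    {x : Coord 𝕜} (h₀ : HasFDerivAt f₀ L₀ x) (h₁ : HasFDerivAt f₁ L₁ x)
    (h₂ : HasFDerivAt f₂ L₂ x) (h₃ : HasFDerivAt f₃ L₃ x) (h₄ : HasFDerivAt f₄ L₄ x) :
    HasFDerivAt (fun x => ![f₀ x, f₁ x, f₂ x, f₃ x, f₄ x])
      (ContinuousLinearMap.pi ![L₀, L₁, L₂, L₃, L₄]) x := by
  refine hasFDerivAt_pi.2 fun i => ?_
  fin_cases i
  exacts [h₀, h₁, h₂, h₃, h₄]

theorem hasFDerivAt_coord (x : Coord 𝕜) (i : Fin 5) : HasFDerivAt (fun x : Coord 𝕜 => x i)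
    (ContinuousLinearMap.proj (R := 𝕜) (φ := fun _ : Fin 5 => 𝕜) i) x :=
  (ContinuousLinearMap.proj (R := 𝕜) (φ := fun _ : Fin 5 => 𝕜) i).hasFDerivAt

theorem hasFDerivAt_comp_coord {x : Coord 𝕜} {g : 𝕜 → 𝕜} {g' : 𝕜} (h : HasDerivAt g g' (x 0)) :
    HasFDerivAt (fun x : Coord 𝕜 => g (x 0))
      (g' • ContinuousLinearMap.proj (R := 𝕜) (φ := fun _ : Fin 5 => 𝕜) 0) x :=
  h.comp_hasFDerivAt x (hasFDerivAt_coord x 0)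

/-- The derivative of the flat coordinates. -/
theorem hasFDerivAt_chart {x : Coord 𝕜} (hR : x 0 ^ 3 + 1 ≠ 0) :
    ∃ L : Coord 𝕜 →L[𝕜] Coord 𝕜, HasFDerivAt (chart α β κ) L x ∧ ∀ v : Coord 𝕜, L v =
      ![-(v 0) / 8,
        sqrtTwo 𝕜 * ((48 / κ ^ 3 * x 1 + B' α β κ (x 0) * x 3 + C' α β κ (x 0) * x 4) * v 0 +
          A κ (x 0) * v 1 + B α β κ (x 0) * v 3 + C α β κ (x 0) * v 4),
        sqrtTwo 𝕜 * ((6 / κ ^ 3 * (2 * x 0) * x 1 + E' α β κ (x 0) * x 3) * v 0 +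
          D κ (x 0) * v 1 + E α β κ (x 0) * v 3),
        sqrtTwo 𝕜 * (3 / (4 * κ ^ 3) * (3 * x 0 ^ 2) * x 1 * v 0 + F κ (x 0) * v 1),
        -2 * v 2 + (-96 / κ ^ 6 * (6 * x 0 ^ 2) * x 1 ^ 2 + b' α β κ (x 0) * x 1 * x 3 +
          c' α β κ (x 0) * x 3 ^ 2) * v 0 + (2 * a κ (x 0) * x 1 + b α β κ (x 0) * x 3) * v 1 +
          (b α β κ (x 0) * x 1 + 2 * c α β κ (x 0) * x 3) * v 3] := by
  have hc := hasFDerivAt_coord x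
  have hA := hasFDerivAt_comp_coord (x := x) (hasDerivAt_A (κ := κ))
  have hB := hasFDerivAt_comp_coord (hasDerivAt_B (α := α) (β := β) (κ := κ) hR)
  have hC := hasFDerivAt_comp_coord (hasDerivAt_C (α := α) (β := β) (κ := κ) hR)
  have hD := hasFDerivAt_comp_coord (x := x) (hasDerivAt_D (κ := κ))
  have hE := hasFDerivAt_comp_coord (hasDerivAt_E (α := α) (β := β) (κ := κ) hR)
  have hF := hasFDerivAt_comp_coord (x := x) (hasDerivAt_F (κ := κ))
  have ha := hasFDerivAt_comp_coord (x := x) (hasDerivAt_a (κ := κ))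
  have hb := hasFDerivAt_comp_coord (hasDerivAt_b (α := α) (β := β) (κ := κ) hR)
  have hc' := hasFDerivAt_comp_coord (hasDerivAt_c (α := α) (β := β) (κ := κ) hR)
  refine ⟨_, hasFDerivAt_vec ((hc 0).fun_neg.mul_const (8 : 𝕜)⁻¹)
    ((((hA.fun_mul (hc 1)).fun_add (hB.fun_mul (hc 3))).fun_add
      (hC.fun_mul (hc 4))).const_mul (sqrtTwo 𝕜))
    (((hD.fun_mul (hc 1)).fun_add (hE.fun_mul (hc 3))).const_mul (sqrtTwo 𝕜))
    ((hF.fun_mul (hc 1)).const_mul (sqrtTwo 𝕜))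
    (((((hc 2).const_mul (-2 : 𝕜)).fun_add (ha.fun_mul ((hc 1).pow 2))).fun_add
      ((hb.fun_mul (hc 1)).fun_mul (hc 3))).fun_add (hc'.fun_mul ((hc 3).pow 2))), fun v => ?_⟩
  funext i
  fin_cases i <;> simp <;> ring

end Chart

namespace Chart

variable {𝕜 : Type*} [RCLike 𝕜] {α β κ : 𝕜}

theorem contDiffAt_chart {x : Coord 𝕜} (hR : x 0 ^ 3 + 1 ≠ 0) :
    ContDiffAt 𝕜 ∞ (chart α β κ) x := by
  have hR2 := pow_ne_zero 2 hR
  have hR3 := pow_ne_zero 3 hR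
  refine contDiffAt_pi.2 fun i => ?_
  fin_cases i <;> simp [chart, A, B, C, D, E, F, a, b, c, N, lameY] <;>
    fun_prop (disch := assumption)

theorem fderiv_chart {x : Coord 𝕜} (hR : x 0 ^ 3 + 1 ≠ 0) (v : Coord 𝕜) :
    fderiv 𝕜 (chart α β κ) x v =
      ![-(v 0) / 8,
        sqrtTwo 𝕜 * ((48 / κ ^ 3 * x 1 + B' α β κ (x 0) * x 3 + C' α β κ (x 0) * x 4) * v 0 +
          A κ (x 0) * v 1 + B α β κ (x 0) * v 3 + C α β κ (x 0) * v 4),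
        sqrtTwo 𝕜 * ((6 / κ ^ 3 * (2 * x 0) * x 1 + E' α β κ (x 0) * x 3) * v 0 +
          D κ (x 0) * v 1 + E α β κ (x 0) * v 3),
        sqrtTwo 𝕜 * (3 / (4 * κ ^ 3) * (3 * x 0 ^ 2) * x 1 * v 0 + F κ (x 0) * v 1),
        -2 * v 2 + (-96 / κ ^ 6 * (6 * x 0 ^ 2) * x 1 ^ 2 + b' α β κ (x 0) * x 1 * x 3 +
          c' α β κ (x 0) * x 3 ^ 2) * v 0 + (2 * a κ (x 0) * x 1 + b α β κ (x 0) * x 3) * v 1 +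
          (b α β κ (x 0) * x 1 + 2 * c α β κ (x 0) * x 3) * v 3] := by
  obtain ⟨L, hL, hL'⟩ := hasFDerivAt_chart (α := α) (β := β) (κ := κ) hR
  rw [hL.fderiv, hL']

theorem isInvertible_of_injective {L : Coord 𝕜 →L[𝕜] Coord 𝕜} (h : ∀ v, L v = 0 → v = 0) :
    L.IsInvertible := by
  let e := (LinearEquiv.ofInjectiveEndo (L : Coord 𝕜 →ₗ[𝕜] Coord 𝕜)
    ((injective_iff_map_eq_zero _).2 h)).toContinuousLinearEquiv
  refine ⟨e, ?_⟩
  ext v : 1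
  rfl

theorem isInvertible_fderiv_chart (hκ : κ ≠ 0) {x : Coord 𝕜} (hR : x 0 ^ 3 + 1 ≠ 0)
    (hY : lameY α β (x 0) ≠ 0) : (fderiv 𝕜 (chart α β κ) x).IsInvertible := by
  refine isInvertible_of_injective fun v hv => ?_
  rw [fderiv_chart hR] at hv
  have hs := sqrtTwo_ne_zero (𝕜 := 𝕜)
  have hC : C α β κ (x 0) ≠ 0 := by simp [C, hκ, hY, hR]
  have hE : E α β κ (x 0) ≠ 0 := by simp [E, hκ, hY, hR]
  have hF : F κ (x 0) ≠ 0 := by simp [F, hκ, hR]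
  have v0 : v 0 = 0 := by simpa using congrFun hv 0
  have v1 : v 1 = 0 := by simpa [v0, hF, hs] using congrFun hv 3
  have v3 : v 3 = 0 := by simpa [v0, v1, hE, hs] using congrFun hv 2
  have v4 : v 4 = 0 := by simpa [v0, v1, v3, hC, hs] using congrFun hv 1
  have v2 : v 2 = 0 := by simpa [v0, v1, v3] using congrFun hv 4
  funext i
  fin_cases i <;> assumption

theorem lameS₁_eq (hκ : κ ≠ 0) {x : Coord 𝕜} (hR : x 0 ^ 3 + 1 ≠ 0)
    (hY : lameY α β (x 0) ≠ 0) : lameS₁ α β (κ ^ 2) x =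
      ![-8, -(4 * κ ^ 2 * lameY α β (x 0) / (x 0 ^ 3 + 1) ^ 2 * x 3),
        -(4 * κ ^ 2 * lameY α β (x 0) ^ 4 / (x 0 ^ 3 + 1) ^ 6 * x 4 ^ 2),
        -(4 * κ ^ 2 * lameY α β (x 0) / (x 0 ^ 3 + 1) ^ 2 * x 4),
        192 * (x 0 ^ 3 + 1) ^ 3 / (κ ^ 4 * lameY α β (x 0) ^ 2) * x 1 +
          96 * (x 0 ^ 3 + 1) ^ 2 * x 0 * (α + β * x 0) / (κ ^ 2 * lameY α β (x 0) ^ 2) * x 3 +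
          24 * (9 * α * x 0 ^ 2 + β * (x 0 ^ 6 + 8 * x 0 ^ 3 - 2)) /
            ((x 0 ^ 3 + 1) * lameY α β (x 0)) * x 4] := by
  funext i
  fin_cases i <;> simp [lameS₁, lameX₁, lameX₂] <;> field_simp <;> ring

section Identities

variable {r : 𝕜}

theorem field₁_w₁_y (hR : r ^ 3 + 1 ≠ 0) (hY : lameY α β r ≠ 0) :
    48 / κ ^ 3 * -8 + C α β κ r * (192 * (r ^ 3 + 1) ^ 3 / (κ ^ 4 * lameY α β r ^ 2)) = 0 := by
  rw [C]
  field_simp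
  ring

theorem field₁_w₁_p (hκ : κ ≠ 0) (hR : r ^ 3 + 1 ≠ 0) (hY : lameY α β r ≠ 0) :
    B' α β κ r * -8 - A κ r * (4 * κ ^ 2 * lameY α β r / (r ^ 3 + 1) ^ 2) +
      C α β κ r * (96 * (r ^ 3 + 1) ^ 2 * r * (α + β * r) / (κ ^ 2 * lameY α β r ^ 2)) = 0 := by
  rw [A, B', C, N, N']
  field_simp
  rw [lameY]
  ring

theorem field₁_w₁_q (hR : r ^ 3 + 1 ≠ 0) :
    C' α β κ r * -8 - B α β κ r * (4 * κ ^ 2 * lameY α β r / (r ^ 3 + 1) ^ 2) +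
      C α β κ r * (24 * (9 * α * r ^ 2 + β * (r ^ 6 + 8 * r ^ 3 - 2)) /
        ((r ^ 3 + 1) * lameY α β r)) = 0 := by
  rw [B, C', C, N, Y']
  field_simp
  rw [lameY]
  ring

theorem field₁_w₂_p (hκ : κ ≠ 0) (hR : r ^ 3 + 1 ≠ 0) :
    E' α β κ r * -8 - D κ r * (4 * κ ^ 2 * lameY α β r / (r ^ 3 + 1) ^ 2) = -2 * B α β κ r := by
  rw [E', D, B, N, Y']
  field_simp
  rw [lameY]
  ring

theorem field₁_w₂_q (hκ : κ ≠ 0) (hR : r ^ 3 + 1 ≠ 0) :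
    -(E α β κ r * (4 * κ ^ 2 * lameY α β r / (r ^ 3 + 1) ^ 2)) = -2 * C α β κ r := by
  rw [E, C]
  field_simp
  ring

theorem field₁_w₃_p (hκ : κ ≠ 0) (hR : r ^ 3 + 1 ≠ 0) :
    -(F κ r * (4 * κ ^ 2 * lameY α β r / (r ^ 3 + 1) ^ 2)) = -3 * E α β κ r := by
  rw [E, F]
  field_simp

theorem field₁_w₄_yp (hκ : κ ≠ 0) (hR : r ^ 3 + 1 ≠ 0) :
    b' α β κ r * -8 - 2 * a κ r * (4 * κ ^ 2 * lameY α β r / (r ^ 3 + 1) ^ 2) =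
      4 * A κ r * B α β κ r := by
  rw [b', a, A, B, N, Y']
  field_simp
  rw [lameY]
  ring

theorem field₁_w₄_pp (hκ : κ ≠ 0) (hR : r ^ 3 + 1 ≠ 0) :
    c' α β κ r * -8 - b α β κ r * (4 * κ ^ 2 * lameY α β r / (r ^ 3 + 1) ^ 2) =
      2 * B α β κ r ^ 2 := by
  rw [b, c', B, N, N', Y']
  field_simp
  rw [lameY]
  ring

theorem field₁_w₄_yq (hκ : κ ≠ 0) (hR : r ^ 3 + 1 ≠ 0) :
    -(b α β κ r * (4 * κ ^ 2 * lameY α β r / (r ^ 3 + 1) ^ 2)) = 4 * A κ r * C α β κ r := by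
  rw [b, A, C]
  field_simp
  ring

theorem field₁_w₄_pq (hκ : κ ≠ 0) (hR : r ^ 3 + 1 ≠ 0) :
    -(2 * c α β κ r * (4 * κ ^ 2 * lameY α β r / (r ^ 3 + 1) ^ 2)) =
      4 * B α β κ r * C α β κ r := by
  rw [c, B, C]
  field_simp

theorem field₁_w₄_qq (hR : r ^ 3 + 1 ≠ 0) :
    8 * κ ^ 2 * lameY α β r ^ 4 / (r ^ 3 + 1) ^ 6 = 2 * C α β κ r ^ 2 := by
  rw [C]
  field_simp
  ring

theorem fieldZ_w₁ (hκ : κ ≠ 0) (hR : r ^ 3 + 1 ≠ 0) (hY : lameY α β r ≠ 0) :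
    A κ r * -(κ ^ 3 * r / (4 * (r ^ 3 + 1))) + B α β κ r * (κ / 2 * ((4 * r ^ 3 + 1) / lameY α β r))
      + C α β κ r * -(2 / κ *
        ((r ^ 3 + 1) ^ 3 * (6 * α * r ^ 2 + β * (5 * r ^ 3 - 1)) / lameY α β r ^ 3)) = 0 := by
  rw [A, B, C, N]
  field_simp
  rw [lameY]
  ring

theorem fieldZ_w₂ (hκ : κ ≠ 0) (hR : r ^ 3 + 1 ≠ 0) (hY : lameY α β r ≠ 0) :
    D κ r * -(κ ^ 3 * r / (4 * (r ^ 3 + 1))) +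
      E α β κ r * (κ / 2 * ((4 * r ^ 3 + 1) / lameY α β r)) = 1 / 2 := by
  rw [D, E]
  field_simp
  ring

theorem fieldZ_w₃ (hκ : κ ≠ 0) (hR : r ^ 3 + 1 ≠ 0) :
    F κ r * -(κ ^ 3 * r / (4 * (r ^ 3 + 1))) = -(3 / 16) * r := by
  rw [F]
  field_simp
  ring

theorem fieldZ_w₄_y (hκ : κ ≠ 0) (hR : r ^ 3 + 1 ≠ 0) (hY : lameY α β r ≠ 0) :
    2 * a κ r * -(κ ^ 3 * r / (4 * (r ^ 3 + 1))) +
      b α β κ r * (κ / 2 * ((4 * r ^ 3 + 1) / lameY α β r)) = -2 * A κ r := by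
  rw [a, b, A]
  field_simp
  ring

theorem fieldZ_w₄_p (hκ : κ ≠ 0) (hR : r ^ 3 + 1 ≠ 0) (hY : lameY α β r ≠ 0) :
    8 * β / κ + b α β κ r * -(κ ^ 3 * r / (4 * (r ^ 3 + 1))) +
      2 * c α β κ r * (κ / 2 * ((4 * r ^ 3 + 1) / lameY α β r)) = -2 * B α β κ r := by
  rw [b, c, B, N]
  field_simp
  rw [lameY]
  ring

end Identities

end Chart

namespace Chart

open MvPolynomial

variable {𝕜 : Type*} [RCLike 𝕜] {α β κ : 𝕜}

theorem evalField_S₁ (y : Coord 𝕜) :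
    Flat.evalField Flat.S₁ y = ![1, 0, -2 * y 1, -3 * y 2, y 1 ^ 2] := by
  funext i
  fin_cases i <;> simp [Flat.evalField, Flat.S₁, mkDerivation_X]

theorem evalField_S₂ (y : Coord 𝕜) : Flat.evalField Flat.S₂ y = ![0, 1, 0, 0, 0] := by
  funext i
  fin_cases i <;> simp [Flat.evalField, Flat.S₂, mkDerivation_X]

theorem evalField_S₃ (y : Coord 𝕜) :
    Flat.evalField Flat.S₃ y = -(2 * y 0 ^ 2 * y 1 + y 0 * y 2 - y 3) •
        ![1, 0, -2 * y 1, -3 * y 2, y 1 ^ 2]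
      + (-3 * y 4 - 3 * y 0 * y 1 ^ 2 - 4 * y 1 * y 2) • ![0, 1, 0, 0, 0]
      - (y 0 * y 1 + y 2) ^ 2 • ![0, 0, 1, 3 * y 0, -2 * y 1] := by
  funext i
  fin_cases i <;> simp [Flat.evalField, Flat.S₃, mkDerivation_X] <;> ring

variable {x : Coord 𝕜}

theorem fderiv_chart_lameS₁ (hκ : κ ≠ 0) (hR : x 0 ^ 3 + 1 ≠ 0) (hY : lameY α β (x 0) ≠ 0) :
    fderiv 𝕜 (chart α β κ) x (lameS₁ α β (κ ^ 2) x) =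
      Flat.evalField Flat.S₁ (chart α β κ x) := by
  rw [fderiv_chart hR, lameS₁_eq hκ hR hY, evalField_S₁]
  have hA : A κ (x 0) = 48 / κ ^ 3 * x 0 := rfl
  have hD : D κ (x 0) = 6 / κ ^ 3 * x 0 ^ 2 := rfl
  funext i
  fin_cases i <;> simp [chart]
  · right
    linear_combination x 1 * field₁_w₁_y (α := α) (β := β) (κ := κ) hR hY +
      x 3 * field₁_w₁_p hκ hR hY + x 4 * field₁_w₁_q (α := α) (β := β) (κ := κ) hR
  · rw [hA]
    linear_combination sqrtTwo 𝕜 * (x 3 * field₁_w₂_p (α := α) (β := β) hκ hR +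
      x 4 * field₁_w₂_q (α := α) (β := β) hκ hR)
  · rw [hD]
    linear_combination sqrtTwo 𝕜 * x 3 * field₁_w₃_p (α := α) (β := β) hκ hR
  · linear_combination x 1 * x 3 * field₁_w₄_yp (α := α) (β := β) hκ hR +
      x 3 ^ 2 * field₁_w₄_pp (α := α) (β := β) hκ hR +
      x 1 * x 4 * field₁_w₄_yq (α := α) (β := β) hκ hR +
      x 3 * x 4 * field₁_w₄_pq (α := α) (β := β) hκ hR +
      x 4 ^ 2 * field₁_w₄_qq (α := α) (β := β) (κ := κ) hR -
      (A κ (x 0) * x 1 + B α β κ (x 0) * x 3 + C α β κ (x 0) * x 4) ^ 2 * sqrtTwo_sq (𝕜 := 𝕜) -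
      2 * x 1 ^ 2 * (A κ (x 0) + 48 / κ ^ 3 * x 0) * hA

theorem fderiv_chart_lameS₂ (hκ : κ ≠ 0) (hR : x 0 ^ 3 + 1 ≠ 0) (hY : lameY α β (x 0) ≠ 0) :
    fderiv 𝕜 (chart α β κ) x (lameS₂ α β κ x) = Flat.evalField Flat.S₂ (chart α β κ x) := by
  rw [fderiv_chart hR, evalField_S₂]
  have h : C α β κ (x 0) * (sqrtTwo 𝕜 * (x 0 ^ 3 + 1) ^ 3 / (4 * κ * lameY α β (x 0) ^ 2)) =
      sqrtTwo 𝕜 / 2 := by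
    rw [C]
    field_simp
    ring
  funext i
  fin_cases i <;> simp [lameS₂, lameX₁]
  rw [h]
  linear_combination (1 / 2) * sqrtTwo_sq (𝕜 := 𝕜)

theorem fderiv_chart_lameZ₁ (hκ : κ ≠ 0) (hR : x 0 ^ 3 + 1 ≠ 0) (hY : lameY α β (x 0) ≠ 0) :
    fderiv 𝕜 (chart α β κ) x (lameZ₁ α β (κ ^ 2) κ x) =
      ![0, 0, 1, 3 * chart α β κ x 0, -2 * chart α β κ x 1] := by
  have hs : κ / sqrtTwo 𝕜 = sqrtTwo 𝕜 * (κ / 2) := by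
    rw [div_eq_iff sqrtTwo_ne_zero]
    linear_combination (-κ / 2) * sqrtTwo_sq (𝕜 := 𝕜)
  have hz : lameZ₁ α β (κ ^ 2) κ x =
      ![0, sqrtTwo 𝕜 * -(κ ^ 3 * x 0 / (4 * (x 0 ^ 3 + 1))),
        sqrtTwo 𝕜 * (-(4 * β / κ) * x 3 + C α β κ (x 0) * x 4),
        sqrtTwo 𝕜 * (κ / 2 * ((4 * x 0 ^ 3 + 1) / lameY α β (x 0))),
        sqrtTwo 𝕜 * -(2 / κ * ((x 0 ^ 3 + 1) ^ 3 *
          (6 * α * x 0 ^ 2 + β * (5 * x 0 ^ 3 - 1)) / lameY α β (x 0) ^ 3))] := by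
    funext i
    fin_cases i <;> simp [lameZ₁, hs, C]
    · ring
    · field_simp
      ring
    · ring
    · ring
  rw [fderiv_chart hR, hz]
  have h₁ := fieldZ_w₁ hκ hR hY
  have h₂ := fieldZ_w₂ hκ hR hY
  have h₃ := fieldZ_w₃ hκ hR
  have h₄ := fieldZ_w₄_y hκ hR hY
  have h₅ := fieldZ_w₄_p hκ hR hY
  have h := sqrtTwo_sq (𝕜 := 𝕜)
  funext i
  fin_cases i <;> simp only [chart, Fin.zero_eta, Fin.mk_one, Fin.reduceFinMk, Matrix.cons_val]
  · simp
  · linear_combination sqrtTwo 𝕜 ^ 2 * h₁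
  · linear_combination sqrtTwo 𝕜 ^ 2 * h₂ + (1 / 2) * h
  · linear_combination sqrtTwo 𝕜 ^ 2 * h₃ - (3 / 16) * x 0 * h
  · linear_combination sqrtTwo 𝕜 * (x 1 * h₄ + x 3 * h₅)

theorem lameC₁_eq (hκ : κ ≠ 0) (hR : x 0 ^ 3 + 1 ≠ 0) : lameC₁ α β κ x =
    2 * chart α β κ x 0 ^ 2 * chart α β κ x 1 + chart α β κ x 0 * chart α β κ x 2 -
      chart α β κ x 3 := by
  simp only [lameC₁, chart, Matrix.cons_val, A, B, C, D, E, F, N]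
  field_simp
  rw [lameY]
  ring

theorem lameC₃_eq (hκ : κ ≠ 0) (hR : x 0 ^ 3 + 1 ≠ 0) : lameC₃ α β κ x =
    chart α β κ x 0 * chart α β κ x 1 + chart α β κ x 2 := by
  simp only [lameC₃, chart, Matrix.cons_val, A, B, C, D, E, N]
  field_simp
  rw [lameY]
  ring

theorem lameC₂_eq (hκ : κ ≠ 0) (hR : x 0 ^ 3 + 1 ≠ 0) : lameC₂ α β (κ ^ 2) x =
    -3 * chart α β κ x 4 - 3 * chart α β κ x 0 * chart α β κ x 1 ^ 2 -
      4 * chart α β κ x 1 * chart α β κ x 2 := by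
  have h : -3 * chart α β κ x 4 - 3 * chart α β κ x 0 * chart α β κ x 1 ^ 2 -
      4 * chart α β κ x 1 * chart α β κ x 2 =
      -3 * (-2 * x 2 + a κ (x 0) * x 1 ^ 2 + b α β κ (x 0) * x 1 * x 3 + c α β κ (x 0) * x 3 ^ 2) +
        3 / 4 * x 0 * (A κ (x 0) * x 1 + B α β κ (x 0) * x 3 + C α β κ (x 0) * x 4) ^ 2 -
        8 * (A κ (x 0) * x 1 + B α β κ (x 0) * x 3 + C α β κ (x 0) * x 4) *
          (D κ (x 0) * x 1 + E α β κ (x 0) * x 3) := by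
    simp only [chart, Matrix.cons_val]
    linear_combination (3 / 8 * x 0 *
      (A κ (x 0) * x 1 + B α β κ (x 0) * x 3 + C α β κ (x 0) * x 4) ^ 2 -
        4 * (A κ (x 0) * x 1 + B α β κ (x 0) * x 3 + C α β κ (x 0) * x 4) *
          (D κ (x 0) * x 1 + E α β κ (x 0) * x 3)) * sqrtTwo_sq (𝕜 := 𝕜)
  rw [h]
  simp only [lameC₂, A, B, C, D, E, a, b, c, N]
  field_simp
  rw [lameY]
  ring

theorem fderiv_chart_lameS₃ (hκ : κ ≠ 0) (hR : x 0 ^ 3 + 1 ≠ 0) (hY : lameY α β (x 0) ≠ 0) :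
    fderiv 𝕜 (chart α β κ) x (lameS₃ α β (κ ^ 2) κ x) =
      Flat.evalField Flat.S₃ (chart α β κ x) := by
  rw [lameS₃, map_sub, map_add, map_neg, map_smul, map_smul, map_smul,
    fderiv_chart_lameS₁ hκ hR hY, fderiv_chart_lameS₂ hκ hR hY, fderiv_chart_lameZ₁ hκ hR hY,
    lameC₁_eq hκ hR, lameC₂_eq hκ hR, lameC₃_eq hκ hR, evalField_S₁, evalField_S₂, evalField_S₃,
    neg_smul]

end Chart

/-! ### The Cartan distribution in flat coordinates -/

namespace Flat

variable {𝕜 : Type*} [RCLike 𝕜]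

/-- The change of coordinates which maps the span of `S₁` and `S₂` to the flat Cartan
distribution. -/
def cartanMap (v : Coord 𝕜) : Coord 𝕜 :=
  ![-(v 3) * 6⁻¹, (v 0 * v 1 ^ 2 + v 1 * v 2 + v 4) * 2⁻¹, -(v 0 * v 1 + v 2) * 2⁻¹, v 0, v 1]

theorem contDiff_cartanMap : ContDiff 𝕜 ∞ (cartanMap (𝕜 := 𝕜)) := by
  refine contDiff_pi.2 fun i => ?_
  fin_cases i <;> simp [cartanMap] <;> fun_prop

theorem fderiv_cartanMap (v w : Coord 𝕜) : fderiv 𝕜 cartanMap v w =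
    ![-(w 3) / 6,
      ((v 1 ^ 2) * w 0 + (2 * v 0 * v 1 + v 2) * w 1 + v 1 * w 2 + w 4) / 2,
      -(v 1 * w 0 + v 0 * w 1 + w 2) / 2, w 0, w 1] := by
  have hc := Chart.hasFDerivAt_coord v
  have h := Chart.hasFDerivAt_vec ((hc 3).fun_neg.mul_const (6 : 𝕜)⁻¹)
    (((((hc 0).fun_mul ((hc 1).pow 2)).fun_add ((hc 1).fun_mul (hc 2))).fun_add
      (hc 4)).mul_const (2 : 𝕜)⁻¹)
    ((((hc 0).fun_mul (hc 1)).fun_add (hc 2)).fun_neg.mul_const (2 : 𝕜)⁻¹) (hc 0) (hc 1)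
  have h' : HasFDerivAt cartanMap _ v := h
  rw [h'.fderiv]
  funext i
  fin_cases i <;> simp <;> ring

theorem isInvertible_fderiv_cartanMap (v : Coord 𝕜) :
    (fderiv 𝕜 cartanMap v).IsInvertible := by
  refine Chart.isInvertible_of_injective fun w hw => ?_
  rw [fderiv_cartanMap] at hw
  have w0 : w 0 = 0 := by simpa using congrFun hw 3
  have w1 : w 1 = 0 := by simpa using congrFun hw 4
  have w2 : w 2 = 0 := by simpa [w0, w1] using congrFun hw 2
  have w3 : w 3 = 0 := by simpa using congrFun hw 0
  have w4 : w 4 = 0 := by simpa [w0, w1, w2] using congrFun hw 1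
  funext i
  fin_cases i <;> assumption

theorem span_eq_flatCartan (v : Coord 𝕜) :
    (Submodule.span 𝕜 {fderiv 𝕜 cartanMap v (evalField S₁ v),
      fderiv 𝕜 cartanMap v (evalField S₂ v)} : Set (Coord 𝕜)) = flatCartan (cartanMap v) := by
  ext w
  rw [SetLike.mem_coe, Submodule.mem_span_pair, fderiv_cartanMap, fderiv_cartanMap,
    Chart.evalField_S₁, Chart.evalField_S₂]
  simp only [flatCartan, cartanMap, Set.mem_ofPred_eq, Matrix.cons_val]
  constructor
  · rintro ⟨s, t, rfl⟩
    simp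
    refine ⟨?_, ?_, ?_⟩ <;> ring
  · rintro ⟨h₀, h₁, h₂⟩
    refine ⟨w 3, w 4, ?_⟩
    funext i
    fin_cases i <;> simp
    · linear_combination -h₀
    · linear_combination -h₁
    · linear_combination -h₂

end Flat

variable {𝕜 : Type*} [RCLike 𝕜] {α β κ : 𝕜} {Ω : TopologicalSpace.Opens (Coord 𝕜)}

theorem span_lameS_eq (hκ : κ ≠ 0) {x : Coord 𝕜} (hR : x 0 ^ 3 + 1 ≠ 0)
    (hY : lameY α β (x 0) ≠ 0) :
    spanDist lameX₁ (lameX₂ α β (κ ^ 2)) x =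
      Submodule.span 𝕜 {lameS₁ α β (κ ^ 2) x, lameS₂ α β κ x} := by
  have hs := Chart.sqrtTwo_ne_zero (𝕜 := 𝕜)
  have h₂ : sqrtTwo 𝕜 * (x 0 ^ 3 + 1) ^ 3 / (4 * κ * lameY α β (x 0) ^ 2) ≠ 0 := by
    simp [hs, hR, hκ, hY]
  have h₁ : 4 * κ ^ 2 * (x 0 ^ 3 + 1) ^ 2 / lameY α β (x 0) ^ 2 ≠ 0 := by simp [hR, hκ, hY]
  simp only [lameS₁, lameS₂, spanDist]
  generalize sqrtTwo 𝕜 * (x 0 ^ 3 + 1) ^ 3 / (4 * κ * lameY α β (x 0) ^ 2) = s at h₂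
  generalize 4 * κ ^ 2 * (x 0 ^ 3 + 1) ^ 2 / lameY α β (x 0) ^ 2 = t at h₁
  generalize (24 : 𝕜) * _ = u
  apply le_antisymm <;> rw [Submodule.span_le, Set.pair_subset_iff] <;>
    simp only [SetLike.mem_coe, Submodule.mem_span_pair]
  · refine ⟨⟨0, s⁻¹, ?_⟩, -t⁻¹, t⁻¹ * u * s⁻¹, ?_⟩
    · rw [zero_smul, zero_add, inv_smul_smul₀ h₂]
    · simp only [smul_sub, smul_smul, mul_assoc, inv_mul_cancel₀ h₂, neg_mul, inv_mul_cancel₀ h₁]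
      module
  · exact ⟨⟨u, -t, by module⟩, s, 0, by module⟩

theorem isMaximallySymmetric_lame (hκ : κ ≠ 0)
    (hΩ : (Ω : Set (Coord 𝕜)) ⊆ lameDomain α β) :
    IsMaximallySymmetric (spanDist lameX₁ (lameX₂ α β (κ ^ 2))) Ω := by
  have hd (x : Coord 𝕜) (hx : x ∈ Ω) : fderiv 𝕜 (Flat.cartanMap ∘ Chart.chart α β κ) x =
      (fderiv 𝕜 Flat.cartanMap (Chart.chart α β κ x)).comp (fderiv 𝕜 (Chart.chart α β κ) x) :=
    fderiv_comp x (Flat.contDiff_cartanMap.contDiffAt.differentiableAt (by simp))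
      ((Chart.contDiffAt_chart (hΩ hx).1).differentiableAt (by simp))
  refine isMaximallySymmetric_of_fderiv_image (φ := Flat.cartanMap ∘ Chart.chart α β κ)
    (fun x hx => (Flat.contDiff_cartanMap.contDiffAt.comp x
      (Chart.contDiffAt_chart (hΩ hx).1)).contDiffWithinAt) (fun x hx => ?_) fun x hx => ?_
  · rw [hd x hx]
    exact (Flat.isInvertible_fderiv_cartanMap _).comp
      (Chart.isInvertible_fderiv_chart hκ (hΩ hx).1 (hΩ hx).2)
  · rw [hd x hx, span_lameS_eq hκ (hΩ hx).1 (hΩ hx).2, Function.comp_apply,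
      ← Flat.span_eq_flatCartan, ← Chart.fderiv_chart_lameS₁ hκ (hΩ hx).1 (hΩ hx).2,
      ← Chart.fderiv_chart_lameS₂ hκ (hΩ hx).1 (hΩ hx).2]
    have h := Submodule.map_span ((fderiv 𝕜 Flat.cartanMap (Chart.chart α β κ x)).comp
      (fderiv 𝕜 (Chart.chart α β κ) x) : Coord 𝕜 →ₗ[𝕜] Coord 𝕜)
      {lameS₁ α β (κ ^ 2) x, lameS₂ α β κ x}
    rw [Set.image_pair] at h
    exact congrArg SetLike.coe h

/-! ### The `(2,3,5)` property and the annihilator -/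

theorem mem_spanDist_lame_iff {k : 𝕜} (hk : k ≠ 0) {x : Coord 𝕜} (hx : x ∈ lameDomain α β) {t : 𝕜}
    (ht : t ^ 3 = x 0 ^ 3 + 1) (v : Coord 𝕜) :
    v ∈ spanDist lameX₁ (lameX₂ α β k) x ↔
      lameOmega₁ α β k t x v = 0 ∧ lameOmega₂ α β k t x v = 0 ∧ lameOmega₃ α β k t x v = 0 := by
  obtain ⟨hR, hY⟩ := hx
  have ht₀ : t ≠ 0 := by
    rintro rfl
    exact hR (by rw [← ht]; simp)
  have hΦ : lamePhi α β (x 0) t = lameY α β (x 0) / t ^ 4 := by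
    rw [lamePhi, lameY]
    field_simp
  rw [spanDist, Submodule.mem_span_pair, lameOmega₁, lameOmega₂, lameOmega₃, hΦ]
  simp only [lameX₁, lameX₂, ← ht]
  generalize lameY α β (x 0) = Y at hY
  constructor
  · rintro ⟨a, b, rfl⟩
    simp
    refine ⟨?_, ?_, ?_⟩ <;> field_simp <;> ring
  · rintro ⟨h₁, h₂, h₃⟩
    refine ⟨v 4, v 0 * (k * (t ^ 3) ^ 2 / (2 * Y ^ 2)), ?_⟩
    rw [sub_eq_zero] at h₁ h₂ h₃
    funext i
    fin_cases i <;> simp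
    · field_simp
    · rw [h₁]
      field_simp
    · rw [h₃]
      field_simp
    · rw [h₂]
      field_simp

section Derived

variable {𝕜 : Type*} [RCLike 𝕜]

/-- The vector field `g ∂_r + f p ∂_y + f q ∂_p + f² q² ∂_z`, where `f` and `g` depend on `r`
only. -/
def mongeField (f g : 𝕜 → 𝕜) (x : Coord 𝕜) : Coord 𝕜 :=
  ![g (x 0), f (x 0) * x 3, f (x 0) ^ 2 * x 4 ^ 2, f (x 0) * x 4, 0]

variable {f g : 𝕜 → 𝕜} {x : Coord 𝕜}

theorem fderiv_mongeField {f' g' : 𝕜} (hf : HasDerivAt f f' (x 0)) (hg : HasDerivAt g g' (x 0))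
    (v : Coord 𝕜) : fderiv 𝕜 (mongeField f g) x v =
      ![g' * v 0, f' * v 0 * x 3 + f (x 0) * v 3,
        2 * f (x 0) * f' * v 0 * x 4 ^ 2 + 2 * f (x 0) ^ 2 * x 4 * v 4,
        f' * v 0 * x 4 + f (x 0) * v 4, 0] := by
  have hc := Chart.hasFDerivAt_coord x
  have hf := Chart.hasFDerivAt_comp_coord hf
  have h : HasFDerivAt (mongeField f g) _ x :=
    Chart.hasFDerivAt_vec (Chart.hasFDerivAt_comp_coord hg) (hf.fun_mul (hc 3))
      ((hf.pow 2).fun_mul ((hc 4).pow 2)) (hf.fun_mul (hc 4)) (hasFDerivAt_const 0 x)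
  rw [h.fderiv]
  funext i
  fin_cases i <;> simp <;> ring

theorem fderiv_lameX₁ : fderiv 𝕜 (lameX₁ (𝕜 := 𝕜)) x = 0 :=
  fderiv_const_apply _

theorem lieBracket_lameX₁_mongeField (hf : DifferentiableAt 𝕜 f (x 0))
    (hg : DifferentiableAt 𝕜 g (x 0)) :
    VectorField.lieBracket 𝕜 lameX₁ (mongeField f g) x =
      ![0, 0, 2 * f (x 0) ^ 2 * x 4, f (x 0), 0] := by
  rw [VectorField.lieBracket_eq]
  beta_reduce
  rw [fderiv_lameX₁, fderiv_mongeField hf.hasDerivAt hg.hasDerivAt]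
  funext i
  fin_cases i <;> simp [lameX₁]

theorem fderiv_lieBracket {f' : 𝕜} (hf : HasDerivAt f f' (x 0)) (v : Coord 𝕜) :
    fderiv 𝕜 (fun x : Coord 𝕜 => ![0, 0, 2 * f (x 0) ^ 2 * x 4, f (x 0), 0]) x v =
      ![0, 0, 4 * f (x 0) * f' * v 0 * x 4 + 2 * f (x 0) ^ 2 * v 4, f' * v 0, 0] := by
  have hf := Chart.hasFDerivAt_comp_coord hf
  have h := Chart.hasFDerivAt_vec (hasFDerivAt_const (0 : 𝕜) x) (hasFDerivAt_const 0 x)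
      (((hf.pow 2).const_mul 2).fun_mul (Chart.hasFDerivAt_coord x 4)) hf (hasFDerivAt_const 0 x)
  rw [h.fderiv]
  funext i
  fin_cases i <;> simp
  ring

theorem is235_mongeField {Ω : Set (Coord 𝕜)} (hΩ : IsOpen Ω)
    (hf : ∀ x ∈ Ω, DifferentiableAt 𝕜 f (x 0)) (hg : ∀ x ∈ Ω, DifferentiableAt 𝕜 g (x 0))
    (hf₀ : ∀ x ∈ Ω, f (x 0) ≠ 0) (hg₀ : ∀ x ∈ Ω, g (x 0) ≠ 0) :
    Is235 lameX₁ (mongeField f g) Ω := by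
  intro x hx
  set X₃ := VectorField.lieBracket 𝕜 lameX₁ (mongeField f g)
  have hX₃ : X₃ =ᶠ[𝓝 x] fun x => ![0, 0, 2 * f (x 0) ^ 2 * x 4, f (x 0), 0] := by
    filter_upwards [hΩ.mem_nhds hx] with u hu
    exact lieBracket_lameX₁_mongeField (hf u hu) (hg u hu)
  have hX₃x := hX₃.eq_of_nhds
  have hX₄ : VectorField.lieBracket 𝕜 lameX₁ X₃ x = ![0, 0, 2 * f (x 0) ^ 2, 0, 0] := by
    rw [VectorField.lieBracket_eq]
    beta_reduce
    rw [fderiv_lameX₁, hX₃.fderiv_eq, fderiv_lieBracket (hf x hx).hasDerivAt]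
    funext i
    fin_cases i <;> simp [lameX₁]
  obtain ⟨s, t, hX₅⟩ : ∃ s t, VectorField.lieBracket 𝕜 (mongeField f g) X₃ x =
      ![0, -f (x 0) ^ 2, s, t, 0] := by
    refine ⟨4 * f (x 0) * deriv f (x 0) * g (x 0) * x 4, deriv f (x 0) * g (x 0), ?_⟩
    rw [VectorField.lieBracket_eq]
    beta_reduce
    rw [hX₃.fderiv_eq, fderiv_lieBracket (hf x hx).hasDerivAt, hX₃x,
      fderiv_mongeField (hf x hx).hasDerivAt (hg x hx).hasDerivAt]
    funext i
    fin_cases i <;> simp [mongeField]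
    ring
  have hf₀ := hf₀ x hx
  have hg₀ := hg₀ x hx
  have hli : LinearIndependent 𝕜 ![lameX₁ x, mongeField f g x, X₃ x,
      VectorField.lieBracket 𝕜 lameX₁ X₃ x, VectorField.lieBracket 𝕜 (mongeField f g) X₃ x] := by
    rw [Fintype.linearIndependent_iff, hX₃x, hX₄, hX₅]
    intro c hc
    have e0 := congrFun hc 0
    have e1 := congrFun hc 1
    have e2 := congrFun hc 2
    have e3 := congrFun hc 3
    have e4 := congrFun hc 4
    simp [Fin.sum_univ_five, lameX₁, mongeField, hg₀] at e0
    simp [Fin.sum_univ_five, lameX₁, mongeField, e0, hf₀] at e1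
    simp [Fin.sum_univ_five, lameX₁, mongeField, e0, e1, hf₀] at e3
    simp [Fin.sum_univ_five, lameX₁, mongeField, e0, e1, e3, hf₀] at e2
    simp [Fin.sum_univ_five, lameX₁, mongeField] at e4
    intro i
    fin_cases i <;> assumption
  have hrank {n : ℕ} (hn : n ≤ 5) {s : Set (Coord 𝕜)}
      (hs : s = Set.range (![lameX₁ x, mongeField f g x, X₃ x,
        VectorField.lieBracket 𝕜 lameX₁ X₃ x, VectorField.lieBracket 𝕜 (mongeField f g) X₃ x] ∘
          Fin.castLE hn)) : Module.finrank 𝕜 (Submodule.span 𝕜 s) = n := by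
    rw [hs, finrank_span_eq_card (hli.comp _ (Fin.castLE_injective hn)), Fintype.card_fin]
  refine ⟨hrank (by decide) ?_, hrank (by decide) ?_, hrank le_rfl ?_⟩ <;> ext v
  · simp [Fin.exists_fin_succ, eq_comm]
  · simp [Fin.exists_fin_succ, eq_comm]
  · simp
    tauto

theorem is235_lame {α β k : 𝕜} (hk : k ≠ 0) {Ω : Set (Coord 𝕜)} (hΩ : IsOpen Ω)
    (hΩ' : Ω ⊆ lameDomain α β) : Is235 lameX₁ (lameX₂ α β k) Ω := by
  have h : lameX₂ α β k = mongeField (fun r => lameY α β r ^ 3 / (r ^ 3 + 1) ^ 4)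
      (fun r => 2 * lameY α β r ^ 2 / (k * (r ^ 3 + 1) ^ 2)) := by
    funext x i
    fin_cases i <;> simp [lameX₂, mongeField]
    rw [div_pow, ← pow_mul, ← pow_mul]
    exact Or.inl rfl
  have hY (r : 𝕜) : DifferentiableAt 𝕜 (lameY α β) r := Chart.hasDerivAt_Y.differentiableAt
  rw [h]
  refine is235_mongeField hΩ (fun x hx => ?_) (fun x hx => ?_) (fun x hx => ?_) fun x hx => ?_
  · have hR := pow_ne_zero 4 (hΩ' hx).1
    have hY := hY (x 0)
    fun_prop (disch := assumption)
  · have hR := mul_ne_zero hk (pow_ne_zero 2 (hΩ' hx).1)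
    have hY := hY (x 0)
    fun_prop (disch := assumption)
  · simp [(hΩ' hx).1, (hΩ' hx).2]
  · simp [(hΩ' hx).1, (hΩ' hx).2, hk]

end Derived

theorem bracketFamily_map {L L' : Type*} [LieRing L] [LieAlgebra ℝ L] [LieRing L']
    [LieAlgebra ℝ L'] (F : L →ₗ⁅ℝ⁆ L') (S₁ S₂ S₃ : L) (i : Fin 14) :
    bracketFamily (F S₁) (F S₂) (F S₃) i = F (bracketFamily S₁ S₂ S₃ i) := by
  fin_cases i <;> simp [bracketFamily, cartanOne, cartanTwo]

theorem linearIndependent_bracketFamily_pullback {𝕜 : Type*} [RCLike 𝕜]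
    {Ω : TopologicalSpace.Opens (Coord 𝕜)} {φ : Coord 𝕜 → Coord 𝕜} (hφ : ContDiffOn 𝕜 ∞ φ Ω)
    (hinv : ∀ x ∈ Ω, (fderiv 𝕜 φ x).IsInvertible) (hne : (Ω : Set (Coord 𝕜)).Nonempty) :
    LinearIndependent 𝕜 fun i => (bracketFamily (Flat.pullbackHom hφ hinv Flat.S₁)
      (Flat.pullbackHom hφ hinv Flat.S₂) (Flat.pullbackHom hφ hinv Flat.S₃) i).1 := by
  rw [Fintype.linearIndependent_iff]
  intro c hc
  simp only [bracketFamily_map] at hc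
  exact Flat.coeff_eq_zero c (Flat.sum_aeval_eq_zero hφ hinv hne _ c hc)

end LameG2

end

theorem corollary7p1 {𝕜 : Type*} [RCLike 𝕜] (α β k κ : 𝕜) (hk : k ≠ 0) (hκ : κ ^ 2 = k)
    (Ω : TopologicalSpace.Opens (LameG2.Coord 𝕜)) (hne : (Ω : Set (LameG2.Coord 𝕜)).Nonempty)
    (hΩ : (Ω : Set (LameG2.Coord 𝕜)) ⊆ LameG2.lameDomain α β) :
    LameG2.Is235 LameG2.lameX₁ (LameG2.lameX₂ α β k) Ω ∧
    LameG2.IsMaximallySymmetric (LameG2.spanDist LameG2.lameX₁ (LameG2.lameX₂ α β k)) Ω ∧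
    (∀ x ∈ Ω, ∀ t : 𝕜, t ^ 3 = x 0 ^ 3 + 1 → ∀ v : LameG2.Coord 𝕜,
      v ∈ LameG2.spanDist LameG2.lameX₁ (LameG2.lameX₂ α β k) x ↔
        LameG2.lameOmega₁ α β k t x v = 0 ∧ LameG2.lameOmega₂ α β k t x v = 0 ∧
          LameG2.lameOmega₃ α β k t x v = 0) ∧
    ∃ s₁ s₂ s₃ : LameG2.SmoothFields 𝕜 Ω,
      Set.EqOn s₁.1 (LameG2.lameS₁ α β k) Ω ∧
      Set.EqOn s₂.1 (LameG2.lameS₂ α β κ) Ω ∧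
      Set.EqOn s₃.1 (LameG2.lameS₃ α β k κ) Ω ∧
      LameG2.PairwiseBracketGenerateSplitG2 s₁ s₂ s₃ ∧
      LinearIndependent 𝕜 (fun i => (LameG2.bracketFamily s₁ s₂ s₃ i).1) := by
  open LameG2 in
  subst hκ
  have hκ : κ ≠ 0 := fun h => hk (by simp [h])
  have hφ : ContDiffOn 𝕜 ∞ (Chart.chart α β κ) Ω := fun x hx =>
    (Chart.contDiffAt_chart (hΩ hx).1).contDiffWithinAt
  have hinv : ∀ x ∈ Ω, (fderiv 𝕜 (Chart.chart α β κ) x).IsInvertible := fun x hx =>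
    Chart.isInvertible_fderiv_chart hκ (hΩ hx).1 (hΩ hx).2
  have hli := linearIndependent_bracketFamily_pullback hφ hinv hne
  refine ⟨is235_lame hk Ω.isOpen hΩ, isMaximallySymmetric_lame hκ hΩ,
    fun x hx t ht v => mem_spanDist_lame_iff hk (hΩ hx) ht v,
    Flat.pullbackHom hφ hinv Flat.S₁, Flat.pullbackHom hφ hinv Flat.S₂,
    Flat.pullbackHom hφ hinv Flat.S₃,
    fun x hx => Flat.pullbackHom_apply_eq hφ hinv _ hx
      (Chart.fderiv_chart_lameS₁ hκ (hΩ hx).1 (hΩ hx).2),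
    fun x hx => Flat.pullbackHom_apply_eq hφ hinv _ hx
      (Chart.fderiv_chart_lameS₂ hκ (hΩ hx).1 (hΩ hx).2),
    fun x hx => Flat.pullbackHom_apply_eq hφ hinv _ hx
      (Chart.fderiv_chart_lameS₃ hκ (hΩ hx).1 (hΩ hx).2),
    (Flat.shortRootRelations.map _).pairwiseBracketGenerate ?_, hli⟩
  exact LinearIndependent.of_comp (SmoothFields 𝕜 Ω).subtype (hli.restrict_scalars' ℝ)
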